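/- Let $n\ge 1$ be an integer and let $P=x^n+a_1x^{n-1}+\cdots+a_n$ be the general monic polynomial of degree $n$, whose coefficients $a_1,\dots,a_n$ are independent variables over $\mathbb{C}$. Let $R=\mathrm{Res}(P,\partial P/\partial x,x)\in\mathbb{C}[a_1,\dots,a_n]$ be its discriminant polynomial. For $1\le k\le n$ write $a^k=(a_1,\dots,a_{k-1},a_{k+1},\dots,a_n)$ and set $$\tilde D_k=\mathrm{Res}(R,\partial R/\partial a_k,a_k)\in\mathbb{C}[a^k],$$ the resultant (determinant of the Sylvester matrix) of $R$ and $\partial R/\partial a_k$ regarded as polynomials in $a_k$ with coefficients in $\mathbb{C}[a^k]$, taken with their exact degrees in $a_k$. Then, with divisibility understood in $\mathbb{C}[a^k]$: (1) for $1\le k\le n-1$, $\tilde D_k$ is not divisible by $a_i$ for any $1\le i\le n$ with $i\ne k$ and $i\neq n$; (2) $\tilde D_n$ is not divisible by $a_i$ for any $1\le i\le n-1$; (3) for $1\le k\le n-2$, $\tilde D_k$ is divisible by $a_n^{n-k-1}$ and is not divisible by $a_n^{n-k}$; (4) if $n\ge 2$, then $\tilde D_{n-1}$ is divisible by $a_n$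 and is not divisible by $a_n^2$. -/

import Mathlib

namespace DiscriminantProjections

noncomputable section

/-- The set `{1, …, n}` indexing the coefficients `a₁, …, aₙ`. -/
abbrev Idx (n : ℕ) : Type := Set.Icc 1 n

/-- The set `{1, …, n} ∖ {k}` indexing the variables `aᵏ = (a₁, …, aₖ₋₁, aₖ₊₁, …, aₙ)`. -/
abbrev IdxErase {n : ℕ} (k : Idx n) : Type := {j : Idx n // j ≠ k}

/-- The general monic polynomial `P = xⁿ + a₁ xⁿ⁻¹ + ⋯ + aₙ`, a polynomial in `x` with coefficients
in `ℂ[a₁, …, aₙ]`. -/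
def genericPoly (n : ℕ) : Polynomial (MvPolynomial (Idx n) ℂ) :=
  Polynomial.X ^ n +
    ∑ j : Idx n, Polynomial.C (MvPolynomial.X j) * Polynomial.X ^ (n - (j : ℕ))

/-- The discriminant polynomial `R = Res(P, P', x) ∈ ℂ[a₁, …, aₙ]`. -/
def discPoly (n : ℕ) : MvPolynomial (Idx n) ℂ :=
  Polynomial.resultant (genericPoly n) (Polynomial.derivative (genericPoly n))

/-- An element of `ℂ[a₁, …, aₙ]` considered as a polynomial in the single variable `aₖ` with
coefficients in `ℂ[aᵏ]`. -/
def asPolyIn {n : ℕ} (k : Idx n) :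
    MvPolynomial (Idx n) ℂ →ₐ[ℂ] Polynomial (MvPolynomial (IdxErase k) ℂ) :=
  MvPolynomial.aeval fun j =>
    if h : j = k then Polynomial.X else Polynomial.C (MvPolynomial.X ⟨j, h⟩)

/-- `D̃ₖ = Res(R, ∂R/∂aₖ, aₖ) ∈ ℂ[aᵏ]`; the two polynomials have their exact degrees in `aₖ`. -/
def tildeD {n : ℕ} (k : Idx n) : MvPolynomial (IdxErase k) ℂ :=
  Polynomial.resultant (asPolyIn k (discPoly n))
    (asPolyIn k (MvPolynomial.pderiv k (discPoly n)))

end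

end DiscriminantProjections

/-! Divisibility by `aᵢ` is tested by setting `aᵢ = 0` and sending the other variables to
independent transcendentals `yⱼ` of an algebraically closed field (`specialize_eq_zero_iff`). Over
that field `R`, as a polynomial `F` in `t = aₖ`, splits explicitly: its roots are the `t` for which
`P_t` has a double root at some zero `x` of `E`, where `E = xP' - (n-k)P` for `k < n` and `E = P'`
for `k = n`. In both cases `E` does not involve `aₖ`.

The key point is that for `i ≠ n` the roots of `F` are simple. Each `∂/∂yₗ` extends to a derivation
`D` of the algebraic closure. Applied to `P_t(x) = 0` at a double root, it loses the term `P_t'(x) D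
x` and leaves `xⁿ⁻ˡ = -D(t) xⁿ⁻ᵏ`. These relations depend only on `t`, so distinct zeros of `E` give
distinct `t`. As `E` has simple zeros and the degree of `F` does not drop, `Res(F, F') ≠ 0`: this is
(1) and (2).

For (3), the leading coefficient of `R` in `aₖ` is a nonzero constant times `aₙⁿ⁻ᵏ⁻¹`, and it
divides `Res(R, ∂R/∂aₖ)`. For sharpness, `coeff_zero_mul_resultant_derivative` trades that
coefficient for `Res(F, nF - tF')`. The latter survives at `aₙ = 0`, where `R` becomes `± aₙ₋₁²`
times the discriminant in degree `n-1`, with simple nonzero roots in `aₖ`.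

For (4), the same factor `aₙ₋₁²` is a double root of `F` at `aₙ = 0`, which gives one factor `aₙ`.
`coeff_mul_resultant_derivative` extracts that factor, and the remaining resultant is nonzero at `aₙ
= 0`. -/

namespace DiscriminantProjections

open Polynomial

/-! ### Resultant identities with formal degrees. -/

section Resultant

variable {A : Type*} [CommRing A]

/-- Multiplicativity of the resultant in the second argument, for formal degrees. -/
lemma resultant_mul_right_of_le (f g₁ g₂ : A[X]) {m n₁ n₂ : ℕ} (hm : f.natDegree ≤ m)
    (h₁ : g₁.natDegree ≤ n₁) (h₂ : g₂.natDegree ≤ n₂) :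
    resultant f (g₁ * g₂) m (n₁ + n₂) = resultant f g₁ m n₁ * resultant f g₂ m n₂ := by
  obtain ⟨d₁, rfl⟩ := Nat.exists_eq_add_of_le h₁
  obtain ⟨d₂, rfl⟩ := Nat.exists_eq_add_of_le h₂
  rw [show g₁.natDegree + d₁ + (g₂.natDegree + d₂) = g₁.natDegree + g₂.natDegree + (d₁ + d₂) by
    ring, resultant_add_right_deg _ _ _ _ _ natDegree_mul_le, resultant_mul_right _ _ _ _ hm,
    resultant_add_right_deg _ _ _ _ _ le_rfl, resultant_add_right_deg _ _ _ _ _ le_rfl]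
  ring

/-- Multiplicativity of the resultant in the first argument, for formal degrees. -/
lemma resultant_mul_left_of_le (f₁ f₂ g : A[X]) {m₁ m₂ n : ℕ} (hn : g.natDegree ≤ n)
    (h₁ : f₁.natDegree ≤ m₁) (h₂ : f₂.natDegree ≤ m₂) :
    resultant (f₁ * f₂) g (m₁ + m₂) n = resultant f₁ g m₁ n * resultant f₂ g m₂ n := by
  rw [resultant_comm, resultant_mul_right_of_le _ _ _ hn h₁ h₂, resultant_comm f₁,
    resultant_comm f₂, add_mul, pow_add]
  ring

lemma resultant_X_mul_right (f g : A[X]) {m n : ℕ} (hm : f.natDegree ≤ m)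
    (hn : g.natDegree ≤ n) :
    resultant f (X * g) m (n + 1) = (-1) ^ m * f.coeff 0 * resultant f g m n := by
  have h := resultant_X_sub_C_right f m 0 hm
  rw [C_0, sub_zero, ← coeff_zero_eq_eval_zero] at h
  rw [add_comm n 1, resultant_mul_right_of_le f X g hm natDegree_X_le hn, h]

lemma resultant_X_mul_left (f g : A[X]) {m n : ℕ} (hm : f.natDegree ≤ m)
    (hn : g.natDegree ≤ n) :
    resultant (X * f) g (m + 1) n = g.coeff 0 * resultant f g m n := by
  have h := resultant_X_sub_C_left g n 0 hn
  rw [C_0, sub_zero, ← coeff_zero_eq_eval_zero] at h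
  rw [add_comm m 1, resultant_mul_left_of_le X f g hn natDegree_X_le hm, h]

/-- `f(0) Res(f, f') = fₙ Res(f, n f - x f')`. -/
lemma coeff_zero_mul_resultant_derivative (f : A[X]) {n : ℕ} (hf : f.natDegree ≤ n + 1) :
    f.coeff 0 * resultant f (derivative f) (n + 1) n =
      f.coeff (n + 1) *
        resultant f (C ((n : A) + 1) * f - X * derivative f) (n + 1) n := by
  have hd : (derivative f).natDegree ≤ n := (natDegree_derivative_le f).trans (by lia)
  set G := C ((n : A) + 1) * f - X * derivative f with hG
  -- The coefficients of `xⁿ⁺¹` cancel in `G`; this drop of the degree is what produces the factor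
  -- `f.coeff (n + 1)`.
  have hGd : G.natDegree ≤ n := by
    rw [natDegree_le_iff_coeff_eq_zero]
    intro N hN
    obtain ⟨N, rfl⟩ : ∃ M, N = M + 1 := ⟨N - 1, by lia⟩
    rw [hG, coeff_sub, coeff_C_mul, coeff_X_mul, coeff_derivative]
    obtain rfl | hlt := eq_or_ne N n
    · ring
    · rw [coeff_eq_zero_of_natDegree_lt (by lia)]; ring
  have h1 := resultant_X_mul_right f (derivative f) hf hd
  have h2 : X * derivative f = C (-1) * G + f * C ((n : A) + 1) := by
    rw [hG]; simp; ring
  rw [h2, resultant_add_mul_right _ _ _ _ _ (by rw [natDegree_C]; lia) hf, resultant_C_mul_right,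
    resultant_add_right_deg _ _ _ _ 1 hGd] at h1
  have hs : ((-1 : A) ^ (n + 1)) * (-1) ^ (n + 1) = 1 := by
    rw [← mul_pow]; simp
  linear_combination (-(-1 : A) ^ (n + 1)) * h1 +
    (f.coeff (n + 1) * resultant f G (n + 1) n -
      f.coeff 0 * resultant f (derivative f) (n + 1) n) * hs

/-- If `f(0) = s u` and `f'(0) = s v`, the resultant of `f` and `f'` is essentially `s` times the
resultant of `f` and `(u f' - v f) / x`. -/
lemma coeff_mul_resultant_derivative (f : A[X]) {n : ℕ} (hf : f.natDegree ≤ n + 1) (s u v : A)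
    (h0 : f.coeff 0 = s * u) (h1 : (derivative f).coeff 0 = s * v) :
    f.coeff (n + 1) * u ^ (n + 1) * resultant f (derivative f) (n + 1) n =
      (-1) ^ (n + 1) * (s * u) *
        resultant f (C u * (derivative f).divX - C v * f.divX) (n + 1) n := by
  have hd : (derivative f).natDegree ≤ n := (natDegree_derivative_le f).trans (by lia)
  set w := C u * (derivative f).divX - C v * f.divX with hw
  have hwd : w.natDegree ≤ n := by
    refine (natDegree_sub_le _ _).trans (max_le ?_ ?_) <;>
    · refine (natDegree_C_mul_le _ _).trans ?_
      rw [natDegree_divX_eq_natDegree_tsub_one]; lia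
  -- `u f'` and `v f` share the constant term `s u v`, so their difference is divisible by `x`.
  have key : C u * derivative f = X * w + f * C v := by
    have e0 := X_mul_divX_add f
    have e1 := X_mul_divX_add (derivative f)
    rw [h0, C_mul] at e0
    rw [h1, C_mul] at e1
    rw [hw]
    linear_combination C v * e0 - C u * e1
  have h2 := resultant_C_mul_right f (derivative f) (n + 1) (n + 1) u
  rw [key, resultant_add_mul_right _ _ _ _ _ (by rw [natDegree_C]; lia) hf, resultant_X_mul_right f w hf hwd,
    resultant_add_right_deg _ _ _ _ 1 hd, h0] at h2
  linear_combination -h2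

lemma resultant_ne_zero_of_forall_root {L : Type*} [Field L] [IsAlgClosed L] (f g : L[X])
    {n : ℕ} (hf : f ≠ 0) (hg : g.natDegree ≤ n) (h : ∀ x, f.eval x = 0 → g.eval x ≠ 0) :
    resultant f g f.natDegree n ≠ 0 := by
  rw [resultant_eq_prod_eval _ _ _ hg (IsAlgClosed.splits f)]
  refine mul_ne_zero (pow_ne_zero _ (leadingCoeff_ne_zero.2 hf)) ?_
  rw [Ne, Multiset.prod_eq_zero_iff, Multiset.mem_map]
  rintro ⟨x, hx, hx0⟩
  exact h x ((mem_roots hf).1 hx) hx0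

lemma resultant_eq_zero_of_root {L : Type*} [Field L] [IsAlgClosed L] (f g : L[X])
    {n : ℕ} (hf : f ≠ 0) (hg : g.natDegree ≤ n) (x : L) (hx : f.eval x = 0)
    (hx' : g.eval x = 0) : resultant f g f.natDegree n = 0 := by
  rw [resultant_eq_prod_eval _ _ _ hg (IsAlgClosed.splits f)]
  refine mul_eq_zero_of_right _ ?_
  rw [Multiset.prod_eq_zero_iff, Multiset.mem_map]
  exact ⟨x, (mem_roots hf).2 hx, hx'⟩

end Resultant

/-! ### Polynomials with a given coefficient sequence and their discriminants. -/

section GenPoly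

variable {A B : Type*} [CommRing A] [CommRing B]

/-- The polynomial `c₀ xⁿ + c₁ xⁿ⁻¹ + ⋯ + cₙ`. -/
noncomputable def genPoly (n : ℕ) (c : ℕ → A) : A[X] :=
  ∑ j ∈ Finset.range (n + 1), C (c j) * X ^ (n - j)

lemma genPoly_congr {n : ℕ} {c d : ℕ → A} (h : ∀ j ≤ n, c j = d j) :
    genPoly n c = genPoly n d :=
  Finset.sum_congr rfl fun j hj => by rw [h j (Nat.lt_succ_iff.1 (Finset.mem_range.1 hj))]

lemma map_genPoly (φ : A →+* B) (n : ℕ) (c : ℕ → A) :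
    (genPoly n c).map φ = genPoly n (fun j => φ (c j)) := by
  simp [genPoly, Polynomial.map_sum]

lemma natDegree_genPoly_le (n : ℕ) (c : ℕ → A) : (genPoly n c).natDegree ≤ n :=
  natDegree_sum_le_of_forall_le _ _ fun _ _ =>
    (natDegree_C_mul_X_pow_le _ _).trans (Nat.sub_le _ _)

lemma eval_genPoly (n : ℕ) (c : ℕ → A) (x : A) :
    (genPoly n c).eval x = ∑ j ∈ Finset.range (n + 1), c j * x ^ (n - j) := by
  simp [genPoly, eval_finsetSum]

lemma coeff_genPoly (n : ℕ) (c : ℕ → A) {j : ℕ} (hj : j ≤ n) :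
    (genPoly n c).coeff (n - j) = c j := by
  simp only [genPoly, finsetSum_coeff, coeff_C_mul, coeff_X_pow]
  rw [Finset.sum_eq_single j]
  · simp
  · intro l hl hlj
    rw [Finset.mem_range] at hl
    rw [if_neg (by lia), mul_zero]
  · intro h; exact absurd (Finset.mem_range.2 (by lia)) h

lemma coeff_zero_genPoly (n : ℕ) (c : ℕ → A) : (genPoly n c).coeff 0 = c n := by
  simpa using coeff_genPoly n c le_rfl

lemma coeff_top_genPoly (n : ℕ) (c : ℕ → A) : (genPoly n c).coeff n = c 0 := by
  simpa using coeff_genPoly n c (Nat.zero_le n)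

lemma natDegree_genPoly (n : ℕ) (c : ℕ → A) (h : c 0 ≠ 0) : (genPoly n c).natDegree = n :=
  natDegree_eq_of_le_of_coeff_ne_zero (natDegree_genPoly_le n c) (by rwa [coeff_top_genPoly])

lemma leadingCoeff_genPoly (n : ℕ) (c : ℕ → A) (h : c 0 ≠ 0) :
    (genPoly n c).leadingCoeff = c 0 := by
  rw [leadingCoeff, natDegree_genPoly n c h, coeff_top_genPoly]

lemma genPoly_ne_zero (n : ℕ) (c : ℕ → A) (h : c 0 ≠ 0) : genPoly n c ≠ 0 := by
  intro h0
  apply h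
  rw [← coeff_top_genPoly n c, h0, coeff_zero]

lemma X_mul_genPoly (n : ℕ) (c : ℕ → A) (h : c (n + 1) = 0) :
    genPoly (n + 1) c = X * genPoly n c := by
  rw [genPoly, Finset.sum_range_succ, h, genPoly, Finset.mul_sum]
  simp only [map_zero, zero_mul, add_zero]
  refine Finset.sum_congr rfl fun j hj => ?_
  rw [Finset.mem_range] at hj
  rw [show n + 1 - j = (n - j) + 1 by lia]
  ring

lemma derivative_genPoly (n : ℕ) (c : ℕ → A) :
    derivative (genPoly (n + 1) c) = genPoly n (fun j => (((n + 1 - j : ℕ) : A)) * c j) := by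
  rw [genPoly, Finset.sum_range_succ, genPoly, derivative_add, derivative_sum]
  simp only [Nat.sub_self, pow_zero, mul_one, derivative_C, add_zero]
  refine Finset.sum_congr rfl fun j hj => ?_
  rw [derivative_C_mul_X_pow, show n + 1 - j - 1 = n - j by lia, mul_comm (c j)]

lemma X_mul_derivative_genPoly (n : ℕ) (c : ℕ → A) :
    X * derivative (genPoly n c) = genPoly n (fun j => ((n - j : ℕ) : A) * c j) := by
  rw [genPoly, derivative_sum, genPoly, Finset.mul_sum]
  refine Finset.sum_congr rfl fun j hj => ?_
  rw [derivative_C_mul_X_pow]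
  obtain h | h := Nat.eq_zero_or_pos (n - j)
  · simp [h]
  · obtain ⟨m, hm⟩ : ∃ m, n - j = m + 1 := ⟨n - j - 1, by lia⟩
    rw [hm, Nat.add_sub_cancel, C_mul, C_mul]
    ring

/-- The polynomial `x P' - (n - k) P`, which does not involve the coefficient `cₖ` of `P`. -/
noncomputable def polarPoly (n k : ℕ) (c : ℕ → A) : A[X] :=
  genPoly n (fun j => ((k : A) - j) * c j)

lemma X_mul_derivative_eq_polarPoly (n k : ℕ) (c : ℕ → A) :
    X * derivative (genPoly n c) = polarPoly n k c + genPoly n c * C ((n : A) - k) := by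
  rw [X_mul_derivative_genPoly, polarPoly, genPoly, genPoly, genPoly, Finset.sum_mul,
    ← Finset.sum_add_distrib]
  refine Finset.sum_congr rfl fun j hj => ?_
  rw [Finset.mem_range] at hj
  rw [Nat.cast_sub (by lia)]
  simp only [C_mul, C_sub]
  ring

/-- The discriminant `Res(P, P')` of `P = c₀ xⁿ + ⋯ + cₙ`, with formal degrees. -/
noncomputable def formalDisc (n : ℕ) (c : ℕ → A) : A :=
  resultant (genPoly n c) (derivative (genPoly n c)) n (n - 1)

lemma formalDisc_congr {n : ℕ} {c d : ℕ → A} (h : ∀ j ≤ n, c j = d j) :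
    formalDisc n c = formalDisc n d := by
  rw [formalDisc, genPoly_congr h, formalDisc]

lemma map_formalDisc (φ : A →+* B) (n : ℕ) (c : ℕ → A) :
    φ (formalDisc n c) = formalDisc n (fun j => φ (c j)) := by
  rw [formalDisc, ← resultant_map_map, ← derivative_map, map_genPoly, formalDisc]

lemma natDegree_derivative_genPoly_le (n : ℕ) (c : ℕ → A) :
    (derivative (genPoly n c)).natDegree ≤ n - 1 :=
  (natDegree_derivative_le _).trans (Nat.sub_le_sub_right (natDegree_genPoly_le n c) 1)

lemma resultant_X_mul_derivative_genPoly {n : ℕ} (hn : 1 ≤ n) (c : ℕ → A) :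
    resultant (genPoly n c) (X * derivative (genPoly n c)) n n =
      (-1) ^ n * c n * formalDisc n c := by
  have h := resultant_X_mul_right _ _ (natDegree_genPoly_le n c)
    (natDegree_derivative_genPoly_le n c)
  rwa [Nat.sub_add_cancel hn, coeff_zero_genPoly] at h

/-- Modulo `P`, `xP'` equals the polar polynomial, and the factor `x` contributes `± cₙ`. The
variable `cₖ` then occurs only in the second argument, so the resultant becomes a product over zeros
independent of `cₖ`. -/
lemma mul_formalDisc {n : ℕ} (hn : 1 ≤ n) (k : ℕ) (c : ℕ → A) :
    c n * formalDisc n c = resultant (polarPoly n k c) (genPoly n c) n n := by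
  have h := resultant_X_mul_derivative_genPoly hn c
  rw [X_mul_derivative_eq_polarPoly n k, resultant_add_mul_right _ _ _ _ _
    (by rw [natDegree_C]; lia) (natDegree_genPoly_le n c), resultant_comm, pow_mul] at h
  have h1 : ((-1 : A) ^ n) ^ n = (-1) ^ n := by
    obtain he | ho := Nat.even_or_odd n
    · simp [he.neg_one_pow]
    · simp [ho.neg_one_pow]
  have hs : (-1 : A) ^ n * (-1) ^ n = 1 := by rw [← mul_pow]; simp
  rw [h1] at h
  linear_combination (-(-1 : A) ^ n) * h +
    (resultant (polarPoly n k c) (genPoly n c) n n - c n * formalDisc n c) * hs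

/-- The discriminant when the constant coefficient vanishes. -/
lemma formalDisc_of_last_eq_zero {n : ℕ} (hn : 1 ≤ n) (c : ℕ → A) (h : c (n + 1) = 0) :
    formalDisc (n + 1) c = (-1) ^ n * c n ^ 2 * formalDisc n c := by
  have hd : derivative (X * genPoly n c) = X * derivative (genPoly n c) + genPoly n c * 1 := by
    rw [derivative_mul, derivative_X]; ring
  have hdd : (derivative (X * genPoly n c)).natDegree ≤ n := by
    rw [← X_mul_genPoly n c h]
    exact natDegree_derivative_genPoly_le (n + 1) c
  rw [formalDisc, X_mul_genPoly n c h, Nat.add_sub_cancel,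
    resultant_X_mul_left _ _ (natDegree_genPoly_le n c) hdd, hd,
    resultant_add_mul_right _ _ _ _ _ (by simp) (natDegree_genPoly_le n c),
    resultant_X_mul_derivative_genPoly hn]
  simp only [coeff_add, mul_one, coeff_zero_genPoly, mul_coeff_zero, coeff_X_zero, zero_mul,
    zero_add]
  ring

/-- The discriminant when the coefficient of `x` vanishes. -/
lemma formalDisc_of_penultimate_eq_zero (n : ℕ) (c : ℕ → A) (h : c (n + 1) = 0) :
    formalDisc (n + 2) c = c (n + 2) * ((-1) ^ n *
      resultant (genPoly (n + 2) c) (genPoly n (fun j => ((n + 2 - j : ℕ) : A) * c j))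
        (n + 2) n) := by
  rw [formalDisc, show n + 2 - 1 = n + 1 by lia, derivative_genPoly (n + 1) c,
    X_mul_genPoly n _ (by simp [h]),
    resultant_X_mul_right _ _ (natDegree_genPoly_le _ _) (natDegree_genPoly_le _ _),
    coeff_zero_genPoly]
  ring

/-- The discriminant of `c₀ xⁿ + ⋯ + cₙ` as a polynomial in the variable replacing `cₖ`. -/
noncomputable def discIn (n k : ℕ) (c : ℕ → A) : A[X] :=
  formalDisc n (Function.update (fun j => C (c j)) k X)

lemma discIn_congr {n k : ℕ} {c d : ℕ → A} (h : ∀ j ≤ n, j ≠ k → c j = d j) :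
    discIn n k c = discIn n k d := by
  refine formalDisc_congr fun j hj => ?_
  obtain rfl | hk := eq_or_ne j k
  · simp
  · simp [hk, h j hj hk]

lemma map_discIn (φ : A →+* B) (n k : ℕ) (c : ℕ → A) :
    (discIn n k c).map φ = discIn n k (fun j => φ (c j)) := by
  rw [discIn, ← coe_mapRingHom, map_formalDisc, discIn]
  congr 1
  ext1 j
  obtain rfl | hk := eq_or_ne j k
  · simp
  · simp [hk]

lemma eval_discIn (n k : ℕ) (c : ℕ → A) (t : A) :
    (discIn n k c).eval t = formalDisc n (Function.update c k t) := by
  rw [discIn, ← coe_evalRingHom, map_formalDisc]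
  congr 1
  ext1 j
  obtain rfl | hk := eq_or_ne j k
  · simp
  · simp [hk]

end GenPoly

end DiscriminantProjections

namespace DiscriminantProjections

open Polynomial

/-! ### A field of independent transcendentals with its partial derivatives. -/

section Field

/-- An algebraic closure of `ℂ(y₀, y₁, …)`. -/
abbrev GenericField : Type := AlgebraicClosure (FractionRing (MvPolynomial ℕ ℂ))

lemma formallyEtale_genericField :
    Algebra.FormallyEtale (MvPolynomial ℕ ℂ) GenericField :=
  have : Algebra.FormallyEtale (MvPolynomial ℕ ℂ) (FractionRing (MvPolynomial ℕ ℂ)) :=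
    .of_isLocalization (nonZeroDivisors (MvPolynomial ℕ ℂ))
  have : Algebra.FormallyEtale (FractionRing (MvPolynomial ℕ ℂ)) GenericField :=
    .of_isSeparable _ _
  .comp _ (FractionRing (MvPolynomial ℕ ℂ)) _

lemma algebraMap_genericField_injective :
    Function.Injective (algebraMap (MvPolynomial ℕ ℂ) GenericField) := by
  rw [IsScalarTower.algebraMap_eq (MvPolynomial ℕ ℂ) (FractionRing (MvPolynomial ℕ ℂ))]
  exact (algebraMap (FractionRing (MvPolynomial ℕ ℂ)) GenericField).injective.comp
    (IsFractionRing.injective _ _)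

/-- The independent transcendentals `yⱼ`. -/
noncomputable def genericVar (j : ℕ) : GenericField :=
  algebraMap (MvPolynomial ℕ ℂ) GenericField (MvPolynomial.X j)

lemma genericVar_ne_zero (j : ℕ) : genericVar j ≠ 0 := by
  rw [genericVar, Ne, map_eq_zero_iff _ algebraMap_genericField_injective]
  exact MvPolynomial.X_ne_zero j

/-- The partial derivatives extend to the algebraic closure. -/
lemma exists_derivation (l : ℕ) :
    ∃ D : Derivation ℤ GenericField GenericField,
      ∀ j, D (genericVar j) = if j = l then 1 else 0 := by
  have := formallyEtale_genericField
  let D₀ : Derivation ℂ (MvPolynomial ℕ ℂ) GenericField :=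
    MvPolynomial.mkDerivation ℂ (fun j => if j = l then 1 else 0)
  let e := KaehlerDifferential.tensorKaehlerEquivOfFormallyEtale ℂ (MvPolynomial ℕ ℂ) GenericField
  -- Formal étaleness identifies the differentials of the field with the base change of those of the
  -- polynomial ring, so the functional given by `D₀` transfers.
  let ψ := (LinearMap.liftBaseChange GenericField D₀.liftKaehlerDifferential) ∘ₗ e.symm.toLinearMap
  refine ⟨(ψ.compDer (KaehlerDifferential.D ℂ GenericField)).restrictScalars ℤ, fun j => ?_⟩
  have h := KaehlerDifferential.tensorKaehlerEquivOfFormallyEtale_symm_D_algebraMap ℂ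
    (MvPolynomial ℕ ℂ) GenericField (MvPolynomial.X j)
  change LinearMap.liftBaseChange GenericField D₀.liftKaehlerDifferential
    (e.symm (KaehlerDifferential.D ℂ GenericField (algebraMap _ _ (MvPolynomial.X j)))) = _
  rw [h]
  simp [D₀, MvPolynomial.mkDerivation_X]

end Field

/-! ### Factorization of the discriminant as a polynomial in one coefficient. -/

section Roots

variable {L : Type*} [Field L]

lemma genPoly_update {A : Type*} [CommRing A] {n k : ℕ} (hk : k ≤ n) (c : ℕ → A) (t : A) :
    genPoly n (Function.update c k t) =
      genPoly n (Function.update c k 0) + C t * X ^ (n - k) := by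
  have hmem : k ∈ Finset.range (n + 1) := Finset.mem_range.2 (by lia)
  rw [genPoly, genPoly, ← Finset.add_sum_erase _ _ hmem, ← Finset.add_sum_erase _ _ hmem]
  have : ∀ j ∈ (Finset.range (n + 1)).erase k, C (Function.update c k t j) * X ^ (n - j) =
      C (Function.update c k 0 j) * X ^ (n - j) := fun j hj => by
    simp [Finset.ne_of_mem_erase hj]
  rw [Finset.sum_congr rfl this]
  simp
  ring

lemma eval_genPoly_update_C {A : Type*} [CommRing A] {n k : ℕ} (hk : k ≤ n) (c : ℕ → A) (x : A) :
    (genPoly n (Function.update (fun j => C (c j)) k X)).eval (C x) =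
      C ((genPoly n (Function.update c k 0)).eval x) + C (x ^ (n - k)) * X := by
  have h : genPoly n (Function.update (fun j => C (c j)) k 0) =
      (genPoly n (Function.update c k 0)).map C := by
    rw [map_genPoly]
    congr 1
    ext1 j
    obtain rfl | hj := eq_or_ne j k
    · simp
    · simp [hj]
  rw [genPoly_update hk, h]
  rw [eval_add, eval_map, eval₂_at_apply]
  simp only [eval_mul, eval_C, eval_pow, eval_X, C_pow]
  ring

lemma prod_map_linear (S : Multiset L) (a b : L → L) (hb : ∀ x ∈ S, b x ≠ 0) :
    (S.map fun x => C (a x) + C (b x) * X).prod =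
      C (S.map b).prod * ((S.map fun x => -a x / b x).map fun t => X - C t).prod := by
  induction S using Multiset.induction_on with
  | empty => simp
  | cons x S ih =>
    have hx : b x ≠ 0 := hb x (Multiset.mem_cons_self x S)
    have e : C (a x) + C (b x) * X = C (b x) * (X - C (-a x / b x)) := by
      rw [mul_sub, ← C_mul, mul_div_cancel₀ _ hx, C_neg]; ring
    simp only [Multiset.map_cons, Multiset.prod_cons, C_mul]
    rw [ih fun y hy => hb y (Multiset.mem_cons_of_mem hy), e]
    ring

lemma nodup_roots_of_forall_root (f : L[X]) (h : ∀ x, f.eval x = 0 → (derivative f).eval x ≠ 0) :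
    f.roots.Nodup := by
  classical
  rw [Multiset.nodup_iff_count_le_one]
  intro x
  rw [count_roots]
  by_contra! hlt
  have hf : f ≠ 0 := by rintro rfl; simp at hlt
  obtain ⟨h1, h2⟩ := (one_lt_rootMultiplicity_iff_isRoot hf).1 hlt
  exact h x h1 h2

lemma derivative_eval_ne_zero_of_nodup (f : L[X]) (hf : f ≠ 0) (hs : f.roots.Nodup) {x : L}
    (hx : f.eval x = 0) : (derivative f).eval x ≠ 0 := by
  classical
  intro h
  have := (one_lt_rootMultiplicity_iff_isRoot hf).2 ⟨hx, h⟩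
  rw [← count_roots] at this
  exact absurd (Multiset.nodup_iff_count_le_one.1 hs x) (by lia)

variable [IsAlgClosed L]

lemma exists_double_root {n : ℕ} {c : ℕ → L} (h0 : c 0 ≠ 0) (h : formalDisc n c = 0) :
    ∃ x, (genPoly n c).eval x = 0 ∧ (derivative (genPoly n c)).eval x = 0 := by
  by_contra! hc
  have := resultant_ne_zero_of_forall_root _ _ (genPoly_ne_zero n c h0)
    (natDegree_derivative_genPoly_le n c) hc
  rw [natDegree_genPoly n c h0] at this
  exact this h

/-- The resultant of `mul_formalDisc` is evaluated as a product over the zeros `x` of the polar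
polynomial; each `P(x)` is linear in the variable `cₖ`, with slope `xⁿ⁻ᵏ`. -/
lemma mul_discIn_eq_prod [CharZero L] {n k : ℕ} (hk : 1 ≤ k) (hkn : k < n) (c : ℕ → L)
    (h0 : c 0 = 1) :
    C (c n) * discIn n k c = C ((k : L) ^ n) * ((polarPoly n k c).roots.map fun x =>
      C ((genPoly n (Function.update c k 0)).eval x) + C (x ^ (n - k)) * X).prod := by
  have hk0 : (k : L) ≠ 0 := Nat.cast_ne_zero.2 (by lia)
  have hp : polarPoly n k (Function.update (fun j => C (c j)) k X) = (polarPoly n k c).map C := by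
    rw [polarPoly, polarPoly, map_genPoly]
    congr 1
    ext1 j
    obtain rfl | hj := eq_or_ne j k
    · simp
    · simp [hj]
  have hlead : ((k : L) - (0 : ℕ)) * c 0 ≠ 0 := by simpa [h0] using hk0
  have hd : (polarPoly n k c).natDegree = n := natDegree_genPoly _ _ hlead
  have hd' : ((polarPoly n k c).map C).natDegree = n := by
    rw [natDegree_map_eq_of_injective C_injective, hd]
  have hl : (polarPoly n k c).leadingCoeff = k := by
    rw [polarPoly, leadingCoeff_genPoly _ _ hlead, h0]; simp
  have hs := IsAlgClosed.splits (polarPoly n k c)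
  have h := mul_formalDisc (n := n) (by lia) k (Function.update (fun j => C (c j)) k X)
  rw [Function.update_of_ne (by lia), hp] at h
  have h2 := resultant_eq_prod_eval ((polarPoly n k c).map C)
    (genPoly n (Function.update (fun j => C (c j)) k X)) n (natDegree_genPoly_le _ _) (hs.map C)
  rw [hd'] at h2
  rw [discIn, h, h2, leadingCoeff_map_of_injective C_injective, hl, hs.roots_map, Multiset.map_map,
    C_pow]
  congr 2
  exact Multiset.map_congr rfl fun x _ => eval_genPoly_update_C hkn.le c x

/-- For the last coefficient `P'` itself is free of the variable, so its zeros replace those of the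
polar polynomial and every slope is 1. -/
lemma discIn_self_eq_prod [CharZero L] (n : ℕ) (c : ℕ → L) (h0 : c 0 = 1) :
    discIn (n + 1) (n + 1) c = C (((n : L) + 1) ^ (n + 1)) *
      ((derivative (genPoly (n + 1) c)).roots.map fun x =>
        C ((genPoly (n + 1) (Function.update c (n + 1) 0)).eval x) + 1 * X).prod := by
  have hk0 : (n : L) + 1 ≠ 0 := by exact_mod_cast Nat.succ_ne_zero n
  have hp : derivative (genPoly (n + 1) (Function.update (fun j => C (c j)) (n + 1) X)) =
      (derivative (genPoly (n + 1) c)).map C := by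
    rw [derivative_genPoly, derivative_genPoly, map_genPoly]
    refine genPoly_congr fun j hj => ?_
    rw [Function.update_of_ne (by lia)]
    simp
  have hlead : ((n + 1 - 0 : ℕ) : L) * c 0 ≠ 0 := by simpa [h0]
  have hd : (derivative (genPoly (n + 1) c)).natDegree = n := by
    rw [derivative_genPoly, natDegree_genPoly _ _ hlead]
  have hd' : ((derivative (genPoly (n + 1) c)).map C).natDegree = n := by
    rw [natDegree_map_eq_of_injective C_injective, hd]
  have hl : (derivative (genPoly (n + 1) c)).leadingCoeff = (n : L) + 1 := by
    rw [derivative_genPoly, leadingCoeff_genPoly _ _ hlead, h0]; simp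
  have hs := IsAlgClosed.splits (derivative (genPoly (n + 1) c))
  have h2 := resultant_eq_prod_eval ((derivative (genPoly (n + 1) c)).map C)
    (genPoly (n + 1) (Function.update (fun j => C (c j)) (n + 1) X)) (n + 1)
    (natDegree_genPoly_le _ _) (hs.map C)
  have hsign : (-1 : L[X]) ^ ((n + 1) * n) = 1 := by
    rw [mul_comm]; exact (Nat.even_mul_succ_self n).neg_one_pow
  rw [hd'] at h2
  rw [discIn, formalDisc, hp, Nat.add_sub_cancel, resultant_comm, hsign, one_mul, h2,
    leadingCoeff_map_of_injective C_injective, hl, hs.roots_map, Multiset.map_map, C_pow]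
  congr 2
  refine Multiset.map_congr rfl fun x _ => ?_
  have := eval_genPoly_update_C le_rfl c x (n := n + 1)
  simpa using this

end Roots

/-! ### Differentiating double roots of generic polynomials. -/

section Generic

/-- The coefficients of the generic monic polynomial with `aᵢ = 0`. -/
noncomputable def genericCoeff (i j : ℕ) : GenericField :=
  if j = 0 then 1 else if j = i then 0 else genericVar j

lemma genericCoeff_zero (i : ℕ) : genericCoeff i 0 = 1 := if_pos rfl

lemma genericCoeff_self {i : ℕ} (hi : i ≠ 0) : genericCoeff i i = 0 := by
  simp [genericCoeff, hi]

lemma genericCoeff_ne_zero {i j : ℕ} (h : j ≠ i) : genericCoeff i j ≠ 0 := by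
  by_cases hj : j = 0
  · simp [genericCoeff, hj]
  · simp [genericCoeff, hj, h, genericVar_ne_zero]

lemma exists_derivation_genericCoeff {i l : ℕ} (hl : l ≠ 0) (hli : l ≠ i) :
    ∃ D : Derivation ℤ GenericField GenericField,
      ∀ j, D (genericCoeff i j) = if j = l then 1 else 0 := by
  obtain ⟨D, hD⟩ := exists_derivation l
  refine ⟨D, fun j => ?_⟩
  unfold genericCoeff
  split_ifs <;> simp_all

/-- The chain rule for `D (P(x))` has the extra term `P'(x) D x`, which vanishes at a double root;
nothing about `D x` need be known. -/
lemma eval_genPoly_derivation (D : Derivation ℤ GenericField GenericField) (n : ℕ)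
    (c : ℕ → GenericField) (x : GenericField) (h : (genPoly n c).eval x = 0) (h' : (derivative (genPoly n c)).eval x = 0) :
    (genPoly n (fun j => D (c j))).eval x = 0 := by
  have hD : D ((genPoly n c).eval x) = (genPoly n (fun j => D (c j))).eval x +
      (derivative (genPoly n c)).eval x * D x := by
    rw [eval_genPoly, eval_genPoly, map_sum, genPoly, derivative_sum, eval_finsetSum,
      Finset.sum_mul, ← Finset.sum_add_distrib]
    refine Finset.sum_congr rfl fun j _ => ?_
    rw [Derivation.leibniz, Derivation.leibniz_pow, derivative_C_mul_X_pow]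
    simp only [smul_eq_mul, nsmul_eq_mul, eval_mul, eval_C, eval_pow, eval_X]
    ring
  rw [h, h', map_zero, zero_mul, add_zero] at hD
  exact hD.symm

lemma eval_genPoly_single {A : Type*} [CommRing A] {n l : ℕ} (hl : l ≤ n) (b : ℕ → A) (x : A) :
    (genPoly n (fun j => b j * if j = l then 1 else 0)).eval x = b l * x ^ (n - l) := by
  rw [eval_genPoly, Finset.sum_eq_single l]
  · simp
  · intro j _ hj; simp [hj]
  · intro h; exact absurd (Finset.mem_range.2 (by lia)) h

/-- A double root of a member of the pencil `P + t xⁿ⁻ᵏ`, differentiated along `aₗ`. -/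
lemma exists_pow_eq_of_double_root {n k i l : ℕ} (hk : k ≤ n) (hl : l ≠ 0) (hln : l ≤ n)
    (hli : l ≠ i) (hlk : l ≠ k) (t : GenericField) :
    ∃ d, (t = 0 → d = 0) ∧ ∀ x,
      (genPoly n (Function.update (genericCoeff i) k t)).eval x = 0 →
      (derivative (genPoly n (Function.update (genericCoeff i) k t))).eval x = 0 →
      x ^ (n - l) = d * x ^ (n - k) := by
  obtain ⟨D, hD⟩ := exists_derivation_genericCoeff hl hli
  -- Only the coefficients at `l` and `k` have nonconstant values under `D`, with derivatives 1 and
  -- `D t`; hence the witness is the same for every double root.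
  refine ⟨-D t, by rintro rfl; simp, fun x h h' => ?_⟩
  have h1 := eval_genPoly_derivation D n _ x h h'
  have h2 : (fun j => D (Function.update (genericCoeff i) k t j)) =
      Function.update (fun j => 1 * if j = l then (1 : GenericField) else 0) k (D t) := by
    ext1 j
    obtain rfl | hj := eq_or_ne j k
    · simp
    · simp only [Function.update_of_ne hj, hD, one_mul]
  have h3 : Function.update (fun j => 1 * if j = l then (1 : GenericField) else 0) k 0 =
      fun j => 1 * if j = l then (1 : GenericField) else 0 :=
    Function.update_eq_self_iff.2 (by simp [hlk.symm])
  rw [h2, genPoly_update hk, h3, eval_add, eval_genPoly_single hln] at h1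
  simp only [one_mul, eval_mul, eval_C, eval_pow, eval_X] at h1
  linear_combination h1

lemma pow_eq_zero_of_double_root {n k i l : ℕ} (hk : k ≤ n) (hl : l ≠ 0) (hln : l ≤ n)
    (hli : l ≠ i) (hlk : l ≠ k) {x : GenericField}
    (h : (genPoly n (Function.update (genericCoeff i) k 0)).eval x = 0)
    (h' : (derivative (genPoly n (Function.update (genericCoeff i) k 0))).eval x = 0) :
    x ^ (n - l) = 0 := by
  obtain ⟨d, hd, H⟩ := exists_pow_eq_of_double_root hk hl hln hli hlk 0
  rw [H x h h', hd rfl, zero_mul]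

end Generic
end DiscriminantProjections

namespace DiscriminantProjections

open Polynomial

/-! ### Simplicity of the roots of the generic discriminant. -/

section Pencil

lemma C_mul_prod_X_sub_C_facts {L : Type*} [Field L] (γ : L) (hγ : γ ≠ 0) (T : Multiset L) :
    (C γ * (T.map fun t => X - C t).prod).natDegree = T.card ∧
    (C γ * (T.map fun t => X - C t).prod).leadingCoeff = γ ∧
    (C γ * (T.map fun t => X - C t).prod).roots = T := by
  refine ⟨?_, ?_, ?_⟩
  · rw [natDegree_C_mul hγ, natDegree_multiset_prod_X_sub_C_eq_card]
  · rw [leadingCoeff_mul, leadingCoeff_C, (monic_multisetProd_X_sub_C T).leadingCoeff, mul_one]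
  · rw [roots_C_mul _ hγ, roots_multiset_prod_X_sub_C]

/-- A member of the pencil `P + t xⁿ⁻ᵏ` has at most one double root. -/
lemma eq_of_double_roots {n k i : ℕ} (hk : 1 ≤ k) (hkn : k < n) (hin : i ≠ n) (hi : i ≠ 0)
    (hik : i ≠ k)
    {t x y : GenericField}
    (hx : (genPoly n (Function.update (genericCoeff i) k t)).eval x = 0)
    (hx' : (derivative (genPoly n (Function.update (genericCoeff i) k t))).eval x = 0)
    (hy : (genPoly n (Function.update (genericCoeff i) k t)).eval y = 0)
    (hy' : (derivative (genPoly n (Function.update (genericCoeff i) k t))).eval y = 0) :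
    x = y := by
  -- The choice `l = n` reads `1 = d xⁿ⁻ᵏ`; it makes `x` nonzero and fixes `xⁿ⁻ᵏ`.
  obtain ⟨d, -, hd⟩ := exists_pow_eq_of_double_root (n := n) (k := k) (i := i) (l := n) hkn.le
    (by lia) le_rfl hin.symm (by lia) t
  have hdx := hd x hx hx'
  have hdy := hd y hy hy'
  rw [Nat.sub_self, pow_zero] at hdx hdy
  have hd0 : d ≠ 0 := by rintro rfl; simp at hdx
  have hxy : x ^ (n - k) = y ^ (n - k) := mul_left_cancel₀ hd0 (hdx.symm.trans hdy)
  have hx0 : x ^ (n - k) ≠ 0 := by intro h; simp [h] at hdx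
  have hpos : ∀ l, 1 ≤ l → l ≤ n → l ≠ i → x ^ (n - l) = y ^ (n - l) := by
    intro l hl hln hli
    obtain rfl | hlk := eq_or_ne l k
    · exact hxy
    · obtain ⟨e, -, he⟩ := exists_pow_eq_of_double_root (n := n) (k := k) (i := i) (l := l)
        hkn.le (by lia) hln hli hlk t
      rw [he x hx hx', he y hy hy', hxy]
  have hall : ∀ l, l ≤ n → l ≠ i → x ^ (n - l) = y ^ (n - l) := by
    intro l hln hli
    obtain rfl | hl := Nat.eq_zero_or_pos l
    -- The leading coefficient is not a variable, so the equality of `n`-th powers comes from the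
    -- equation itself; the unknown power at index `i` has coefficient 0.
    · rw [eval_genPoly, Finset.sum_range_succ'] at hx hy
      rw [← hy] at hx
      have h0 : Function.update (genericCoeff i) k t 0 = 1 := by
        rw [Function.update_of_ne (by lia), genericCoeff_zero]
      rw [h0, one_mul, one_mul] at hx
      refine (add_right_inj _).1 (hx.trans ?_)
      congr 1
      refine Finset.sum_congr rfl fun j hj => ?_
      rw [Finset.mem_range] at hj
      obtain h | h := eq_or_ne (j + 1) i
      · rw [Function.update_of_ne (by lia), h, genericCoeff_self hi]; simp
      · rw [hpos (j + 1) (by lia) (by lia) h]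
    · exact hpos l hl hln hli
  have hx1 : x ≠ 0 := by rintro rfl; exact hx0 (zero_pow (by lia))
  -- Two consecutive exponents determine `x`; a neighbour of `k` other than `i` is used.
  obtain h | h := eq_or_ne i (k - 1)
  · have h1 := hall (k + 1) (by lia) (by lia)
    have h2 : x ^ (n - (k + 1)) ≠ 0 := pow_ne_zero _ hx1
    rw [show n - k = n - (k + 1) + 1 by lia, pow_succ, pow_succ, ← h1] at hxy
    exact mul_left_cancel₀ h2 hxy
  · have h1 := hall (k - 1) (by lia) h.symm
    rw [show n - (k - 1) = n - k + 1 by lia, pow_succ, pow_succ, ← hxy] at h1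
    exact mul_left_cancel₀ hx0 h1

/-- The roots are the images `τ x` of the `n` zeros of the polar polynomial `E`. They are distinct
because `E` has simple zeros and `τ` is injective on them; the leading coefficient follows from the
product of the zeros (Vieta). -/
lemma discIn_generic_of_lt {n k i : ℕ} (hk : 1 ≤ k) (hkn : k < n) (hin : i ≠ n) (hi : i ≠ 0)
    (hik : i ≠ k) :
    (discIn n k (genericCoeff i)).natDegree = n ∧
    (discIn n k (genericCoeff i)).leadingCoeff =
      (k : GenericField) ^ k * ((-1) ^ n * ((k : GenericField) - n)) ^ (n - k) *
        genericCoeff i n ^ (n - k - 1) ∧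
    (discIn n k (genericCoeff i)).roots.Nodup := by
  set c := genericCoeff i with hc
  set E := polarPoly n k c with hE
  have hk0 : (k : GenericField) ≠ 0 := Nat.cast_ne_zero.2 (by lia)
  have hkn0 : (k : GenericField) - n ≠ 0 := sub_ne_zero.2 (Nat.cast_injective.ne hkn.ne)
  have hc0 : c 0 = 1 := genericCoeff_zero i
  have hcn : c n ≠ 0 := genericCoeff_ne_zero hin.symm
  have hlead : ((k : GenericField) - (0 : ℕ)) * c 0 ≠ 0 := by simpa [hc0] using hk0
  have hEd : E.natDegree = n := natDegree_genPoly _ _ hlead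
  have hEl : E.leadingCoeff = k := by
    rw [hE, polarPoly, leadingCoeff_genPoly _ _ hlead, hc0]; simp
  have hE0 : E.coeff 0 = ((k : GenericField) - n) * c n := coeff_zero_genPoly _ _
  have hEne : E ≠ 0 := genPoly_ne_zero _ _ hlead
  have hs := IsAlgClosed.splits E
  have hcard : E.roots.card = n := by rw [← hEd]; exact hs.natDegree_eq_card_roots.symm
  have hprod : (k : GenericField) * E.roots.prod = (-1) ^ n * (((k : GenericField) - n) * c n) := by
    have h := hs.coeff_zero_eq_leadingCoeff_mul_prod_roots
    rw [hE0, hEd, hEl] at h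
    rw [h]
    have hs : (-1 : GenericField) ^ n * (-1) ^ n = 1 := by rw [← mul_pow]; simp
    linear_combination (-(k : GenericField) * E.roots.prod) * hs
  have hroot : ∀ x ∈ E.roots, x ≠ 0 := by
    rintro x hx rfl
    rw [mem_roots hEne, IsRoot.def, ← coeff_zero_eq_eval_zero, hE0] at hx
    exact mul_ne_zero hkn0 hcn hx
  have hroot' : ∀ x ∈ E.roots, x ^ (n - k) ≠ 0 := fun x hx => pow_ne_zero _ (hroot x hx)
  set τ : GenericField → GenericField :=
    fun x => -(genPoly n (Function.update c k 0)).eval x / x ^ (n - k) with hτ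
  set γ := (k : GenericField) ^ n * (E.roots.map fun x => x ^ (n - k)).prod / c n with hγdef
  have hγ : c n * γ = (k : GenericField) ^ n * E.roots.prod ^ (n - k) := by
    rw [hγdef, mul_div_cancel₀ _ hcn, Multiset.prod_map_pow, Multiset.map_id']
  have hγ0 : γ ≠ 0 := by
    intro h
    rw [h, mul_zero] at hγ
    refine mul_ne_zero (pow_ne_zero _ hk0) (pow_ne_zero _ ?_) hγ.symm
    exact Multiset.prod_ne_zero fun h => hroot 0 h rfl
  have hF : discIn n k c = C γ * ((E.roots.map τ).map fun t => X - C t).prod := by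
    have h := mul_discIn_eq_prod hk hkn c hc0
    rw [← hE, prod_map_linear _ _ _ hroot', ← mul_assoc, ← C_mul] at h
    refine mul_left_cancel₀ (C_ne_zero.2 hcn) (h.trans ?_)
    rw [← mul_assoc, ← C_mul, hγ, Multiset.prod_map_pow, Multiset.map_id']
  -- Differentiating a double zero of `E` along `aₙ` would give `k - n = 0`.
  have hEsep : E.roots.Nodup := by
    refine nodup_roots_of_forall_root _ fun x hx hx' => ?_
    obtain ⟨D, hD⟩ := exists_derivation_genericCoeff (i := i) (l := n) (by lia) hin.symm
    have h := eval_genPoly_derivation D n _ x hx hx'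
    have h2 : (fun j : ℕ => D (((k : GenericField) - j) * c j)) =
        fun j : ℕ => ((k : GenericField) - j) * if j = n then 1 else 0 := by
      ext1 j
      rw [Derivation.leibniz, hc, hD, map_sub, Derivation.map_natCast, Derivation.map_natCast]
      simp
    rw [h2, eval_genPoly_single le_rfl (fun j : ℕ => (k : GenericField) - j), Nat.sub_self,
      pow_zero, mul_one] at h
    exact hkn0 h
  have hdouble : ∀ x ∈ E.roots, (genPoly n (Function.update c k (τ x))).eval x = 0 ∧
      (derivative (genPoly n (Function.update c k (τ x)))).eval x = 0 := by
    intro x hx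
    have h1 : (genPoly n (Function.update c k (τ x))).eval x = 0 := by
      rw [genPoly_update hkn.le]
      simp only [eval_add, eval_mul, eval_C, eval_pow, eval_X, hτ]
      rw [div_mul_cancel₀ _ (hroot' x hx)]
      ring
    have h2 : polarPoly n k (Function.update c k (τ x)) = E := by
      rw [hE, polarPoly, polarPoly]
      congr 1
      ext1 j
      obtain rfl | hj := eq_or_ne j k
      · simp
      · simp [hj]
    have h3 := congrArg (eval x) (X_mul_derivative_eq_polarPoly n k (Function.update c k (τ x)))
    rw [h2, eval_add, eval_mul, eval_mul, h1, zero_mul, add_zero, (mem_roots hEne).1 hx,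
      eval_X] at h3
    exact ⟨h1, (mul_eq_zero.1 h3).resolve_left (hroot x hx)⟩
  have hnd : (E.roots.map τ).Nodup := by
    refine Multiset.Nodup.map_on (fun x hx y hy hxy => ?_) hEsep
    obtain ⟨hx1, hx2⟩ := hdouble x hx
    obtain ⟨hy1, hy2⟩ := hdouble y hy
    rw [← hxy] at hy1 hy2
    exact eq_of_double_roots hk hkn hin hi hik hx1 hx2 hy1 hy2
  obtain ⟨f1, f2, f3⟩ := C_mul_prod_X_sub_C_facts γ hγ0 (E.roots.map τ)
  rw [← hF] at f1 f2 f3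
  refine ⟨by rw [f1, Multiset.card_map, hcard], ?_, by rwa [f3]⟩
  rw [f2]
  refine mul_left_cancel₀ hcn ?_
  rw [hγ]
  calc (k : GenericField) ^ n * E.roots.prod ^ (n - k)
      = (k : GenericField) ^ k * ((k : GenericField) * E.roots.prod) ^ (n - k) := by
        rw [mul_pow, ← mul_assoc, ← pow_add, Nat.add_sub_cancel' hkn.le]
    _ = _ := by
        rw [hprod, ← mul_assoc, mul_pow _ (c n)]
        obtain ⟨m, hm⟩ : ∃ m, n - k = m + 1 := ⟨n - k - 1, by lia⟩
        rw [hm, Nat.add_sub_cancel]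
        ring

/-- The derivative of the generic polynomial of degree `n + 1` has simple roots. -/
lemma nodup_roots_derivative_genPoly {n i : ℕ} (hin : i ≠ n + 1) :
    (derivative (genPoly (n + 1) (genericCoeff i))).roots.Nodup := by
  refine nodup_roots_of_forall_root _ fun x hx hx' => ?_
  obtain rfl | hn := Nat.eq_zero_or_pos n
  · rw [derivative_genPoly, eval_genPoly] at hx
    simp [genericCoeff_zero] at hx
  have key : ∀ l, 1 ≤ l → l ≤ n → l ≠ i → x ^ (n - l) = 0 := by
    intro l hl hln hli
    obtain ⟨D, hD⟩ := exists_derivation_genericCoeff (i := i) (l := l) (by lia) hli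
    rw [derivative_genPoly] at hx hx'
    have h := eval_genPoly_derivation D n _ x hx hx'
    have h2 : (fun j : ℕ => D (((n + 1 - j : ℕ) : GenericField) * genericCoeff i j)) =
        fun j : ℕ => ((n + 1 - j : ℕ) : GenericField) * if j = l then 1 else 0 := by
      ext1 j
      rw [Derivation.leibniz, hD, Derivation.map_natCast]
      simp
    rw [h2, eval_genPoly_single hln (fun j : ℕ => ((n + 1 - j : ℕ) : GenericField))] at h
    exact (mul_eq_zero.1 h).resolve_left (Nat.cast_ne_zero.2 (by lia))
  -- If `aₙ` is available, `l = n` gives `1 = 0`. If `aₙ` is the vanishing coefficient, the root is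
  -- forced to be 0, where the second derivative is a nonzero multiple of the coefficient at `n -
  -- 1`.
  by_cases hni : n = i
  swap
  · simpa using key n hn le_rfl hni
  obtain ⟨m, rfl⟩ : ∃ m, n = m + 1 := ⟨n - 1, by lia⟩
  have hx0 : x = 0 := by
    obtain rfl | hm := Nat.eq_zero_or_pos m
    · rw [derivative_genPoly, eval_genPoly, Finset.sum_range_succ, ← hni,
        genericCoeff_self (by lia)] at hx
      simpa [genericCoeff_zero] using hx
    · have := key m hm (by lia) (by lia)
      rw [show m + 1 - m = 1 by lia, pow_one] at this
      exact this
  rw [hx0, derivative_genPoly, derivative_genPoly, ← coeff_zero_eq_eval_zero,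
    coeff_zero_genPoly] at hx'
  refine mul_ne_zero (Nat.cast_ne_zero.2 (by lia)) (mul_ne_zero (Nat.cast_ne_zero.2 (by lia))
    (genericCoeff_ne_zero (by lia))) hx'

/-- Same scheme as `discIn_generic_of_lt`, with the critical points of `P` and their critical values
(up to sign). -/
lemma discIn_generic_self {n i : ℕ} (hin : i ≠ n + 1) (hi : i ≠ 0) :
    (discIn (n + 1) (n + 1) (genericCoeff i)).natDegree = n ∧
    (discIn (n + 1) (n + 1) (genericCoeff i)).roots.Nodup := by
  set c := genericCoeff i with hc
  set E := derivative (genPoly (n + 1) c) with hE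
  have hc0 : c 0 = 1 := genericCoeff_zero i
  have hn0 : (n : GenericField) + 1 ≠ 0 := by exact_mod_cast Nat.succ_ne_zero n
  have hlead : ((n + 1 - 0 : ℕ) : GenericField) * c 0 ≠ 0 := by simpa [hc0] using hn0
  have hEd : E.natDegree = n := by rw [hE, derivative_genPoly, natDegree_genPoly _ _ hlead]
  have hEne : E ≠ 0 := by rw [hE, derivative_genPoly]; exact genPoly_ne_zero _ _ hlead
  have hs := IsAlgClosed.splits E
  have hcard : E.roots.card = n := by
    rw [← hs.natDegree_eq_card_roots, hEd]
  set P₀ := genPoly (n + 1) (Function.update c (n + 1) 0)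
  set τ : GenericField → GenericField := fun x => -P₀.eval x / 1 with hτ
  have hF : discIn (n + 1) (n + 1) c =
      C (((n : GenericField) + 1) ^ (n + 1)) *
        ((E.roots.map τ).map fun t => X - C t).prod := by
    have h := prod_map_linear E.roots P₀.eval (fun _ => 1) (fun _ _ => one_ne_zero)
    rw [discIn_self_eq_prod n c hc0, ← hE]
    simp only [C_1] at h
    rw [h]
    simp [hτ]
  have hEsep : E.roots.Nodup := nodup_roots_derivative_genPoly hin
  have hEt : ∀ t, derivative (genPoly (n + 1) (Function.update c (n + 1) t)) = E := by
    intro t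
    rw [hE, derivative_genPoly, derivative_genPoly]
    exact genPoly_congr fun j hj => by rw [Function.update_of_ne (by lia)]
  have hdouble : ∀ x ∈ E.roots,
      (genPoly (n + 1) (Function.update c (n + 1) (τ x))).eval x = 0 ∧
      (derivative (genPoly (n + 1) (Function.update c (n + 1) (τ x)))).eval x = 0 := by
    intro x hx
    refine ⟨?_, by rw [hEt]; exact (mem_roots hEne).1 hx⟩
    rw [genPoly_update le_rfl]
    simp [hτ, P₀]
  have hnd : (E.roots.map τ).Nodup := by
    refine Multiset.Nodup.map_on (fun x hx y hy hxy => ?_) hEsep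
    obtain ⟨hx1, hx2⟩ := hdouble x hx
    obtain ⟨hy1, hy2⟩ := hdouble y hy
    rw [← hxy] at hy1 hy2
    have hpos : ∀ l, 1 ≤ l → l ≤ n → l ≠ i → x ^ (n + 1 - l) = y ^ (n + 1 - l) := by
      intro l hl hln hli
      obtain ⟨e, -, he⟩ := exists_pow_eq_of_double_root (n := n + 1) (k := n + 1) (i := i) (l := l)
        le_rfl (by lia) (by lia) hli (by lia) (τ x)
      rw [he x hx1 hx2, he y hy1 hy2]
      simp
    have h0 : x ^ (n + 1) = y ^ (n + 1) := by
      rw [eval_genPoly, Finset.sum_range_succ'] at hx1 hy1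
      rw [← hy1] at hx1
      have h0 : Function.update c (n + 1) (τ x) 0 = 1 := by
        rw [Function.update_of_ne (by lia), hc0]
      rw [h0, one_mul, one_mul] at hx1
      refine (add_right_inj _).1 (hx1.trans ?_)
      congr 1
      refine Finset.sum_congr rfl fun j hj => ?_
      rw [Finset.mem_range] at hj
      obtain h | h := eq_or_ne (j + 1) i
      · rw [Function.update_of_ne (by lia), h, hc, genericCoeff_self hi]; simp
      · obtain hjn | hjn := eq_or_ne j n
        · simp [hjn]
        · rw [hpos (j + 1) (by lia) (by lia) h]
    have hall : ∀ l, l ≤ n → l ≠ i → x ^ (n + 1 - l) = y ^ (n + 1 - l) := by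
      intro l hln hli
      obtain rfl | hl := Nat.eq_zero_or_pos l
      · exact h0
      · exact hpos l hl hln hli
    -- Exponent 1 is available unless `aₙ` was set to 0; in that case squares and cubes determine
    -- `x`, except in degree 2, where 0 is the only critical point.
    by_cases hni : n = i
    swap
    · simpa using hall n le_rfl hni
    obtain ⟨m, rfl⟩ : ∃ m, n = m + 1 := ⟨n - 1, by lia⟩
    obtain rfl | hm := Nat.eq_zero_or_pos m
    · have hz : ∀ z ∈ E.roots, z = 0 := by
        intro z hz
        have := (mem_roots hEne).1 hz
        rw [hE, IsRoot.def, derivative_genPoly, eval_genPoly, Finset.sum_range_succ, hc, ← hni,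
          genericCoeff_self (by lia)] at this
        simpa [genericCoeff_zero] using this
      rw [hz x hx, hz y hy]
    · have h2 := hall m (by lia) (by lia)
      have h3 := hall (m - 1) (by lia) (by lia)
      rw [show m + 1 + 1 - m = 2 by lia] at h2
      rw [show m + 1 + 1 - (m - 1) = 2 + 1 by lia, pow_succ _ 2, pow_succ _ 2, h2] at h3
      obtain hy0 | hy0 := eq_or_ne (y ^ 2) 0
      · rw [hy0] at h2
        rw [pow_eq_zero_iff two_ne_zero] at h2 hy0
        rw [h2, hy0]
      · exact mul_left_cancel₀ hy0 h3
  obtain ⟨f1, f2, f3⟩ := C_mul_prod_X_sub_C_facts (((n : GenericField) + 1) ^ (n + 1))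
    (pow_ne_zero _ hn0) (E.roots.map τ)
  rw [← hF] at f1 f3
  exact ⟨by rw [f1, Multiset.card_map, hcard], by rwa [f3]⟩

end Pencil
end DiscriminantProjections

namespace DiscriminantProjections

open Polynomial

/-! ### Divisibility by a variable as vanishing under specialization. -/

section Specialization

variable {n : ℕ}

/-- The coefficients `1, a₁, …, aₙ` of the general monic polynomial. -/
noncomputable def varCoeff (n j : ℕ) : MvPolynomial (Idx n) ℂ :=
  if j = 0 then 1 else if h : j ∈ Set.Icc 1 n then MvPolynomial.X ⟨j, h⟩ else 0

lemma genericPoly_eq (n : ℕ) : genericPoly n = genPoly n (varCoeff n) := by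
  have hsum : ∑ j : Idx n, C (MvPolynomial.X (R := ℂ) j) * X ^ (n - (j : ℕ)) =
      ∑ j ∈ Finset.Icc 1 n, C (varCoeff n j) * X ^ (n - j) := by
    rw [Finset.sum_subtype (p := (· ∈ Set.Icc 1 n)) _ (by simp)]
    refine Fintype.sum_congr _ _ fun j => ?_
    have h1 : (j : ℕ) ≠ 0 := by have := j.2.1; lia
    have h2 := j.2
    simp only [varCoeff, if_neg h1, dif_pos h2]
  rw [genericPoly, hsum, genPoly, Finset.range_eq_Ico, Finset.sum_eq_sum_Ico_succ_bot (by lia)]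
  simp only [varCoeff, ite_true, C_1, one_mul, Nat.sub_zero]
  rfl

lemma discPoly_eq (n : ℕ) : discPoly n = formalDisc n (varCoeff n) := by
  have h0 : varCoeff n 0 = 1 := if_pos rfl
  rw [discPoly, genericPoly_eq, formalDisc, natDegree_derivative,
    natDegree_genPoly n _ (by rw [h0]; exact one_ne_zero)]

/-- The coefficients `1, a₁, …, aₙ`, with `aₖ` replaced by `0`. -/
noncomputable def varCoeffErase (k : Idx n) (j : ℕ) : MvPolynomial (IdxErase k) ℂ :=
  if j = 0 then 1 else
    if h : ∃ hj : j ∈ Set.Icc 1 n, (⟨j, hj⟩ : Idx n) ≠ k then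
      MvPolynomial.X ⟨⟨j, h.choose⟩, h.choose_spec⟩ else 0

lemma varCoeffErase_coe (k : Idx n) (j : IdxErase k) :
    varCoeffErase k (j : Idx n) = MvPolynomial.X j := by
  have h1 : ((j : Idx n) : ℕ) ≠ 0 := by have := j.1.2.1; lia
  have h : ∃ hj : ((j : Idx n) : ℕ) ∈ Set.Icc 1 n, (⟨_, hj⟩ : Idx n) ≠ k := ⟨j.1.2, j.2⟩
  rw [varCoeffErase, if_neg h1, dif_pos h]

lemma varCoeffErase_zero (k : Idx n) : varCoeffErase k 0 = 1 := if_pos rfl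

lemma asPolyIn_discPoly (k : Idx n) : asPolyIn k (discPoly n) = discIn n k (varCoeffErase k) := by
  rw [discPoly_eq, ← AlgHom.coe_toRingHom, map_formalDisc, discIn]
  refine formalDisc_congr fun j hj => ?_
  obtain rfl | hj0 := Nat.eq_zero_or_pos j
  · rw [Function.update_of_ne (by have := k.2.1; lia), varCoeffErase_zero, varCoeff]
    simp
  · have hmem : j ∈ Set.Icc 1 n := ⟨hj0, hj⟩
    rw [varCoeff, if_neg (by lia), dif_pos hmem]
    simp only [AlgHom.coe_toRingHom, asPolyIn, MvPolynomial.aeval_X]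
    by_cases hk : (⟨j, hmem⟩ : Idx n) = k
    · subst hk; simp
    · have hk' : j ≠ k := fun h => hk (Subtype.ext h)
      rw [dif_neg hk, Function.update_of_ne hk']
      exact congrArg C (varCoeffErase_coe k ⟨⟨j, hmem⟩, hk⟩).symm

lemma asPolyIn_pderiv (k : Idx n) (p : MvPolynomial (Idx n) ℂ) :
    asPolyIn k (MvPolynomial.pderiv k p) = derivative (asPolyIn k p) := by
  induction p using MvPolynomial.induction_on with
  | C a =>
    rw [MvPolynomial.pderiv_C, map_zero, asPolyIn, MvPolynomial.aeval_C,
      Polynomial.algebraMap_apply, derivative_C]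
  | add p q hp hq => simp [hp, hq]
  | mul_X p j hp =>
    have hj : asPolyIn k (MvPolynomial.pderiv k (MvPolynomial.X j)) =
        derivative (asPolyIn k (MvPolynomial.X j)) := by
      rw [MvPolynomial.pderiv_X]
      by_cases h : j = k
      · subst h; simp [asPolyIn]
      · simp [asPolyIn, h]
    rw [Derivation.leibniz, map_mul, derivative_mul]
    simp only [smul_eq_mul, map_add, map_mul, hp, hj]
    ring

/-- In characteristic zero the derivative has degree exactly one less. Writing the degrees
explicitly keeps them fixed when a specialization lowers the actual degree. -/
lemma tildeD_eq (k : Idx n) :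
    tildeD k = resultant (discIn n k (varCoeffErase k)) (derivative (discIn n k (varCoeffErase k)))
      (discIn n k (varCoeffErase k)).natDegree ((discIn n k (varCoeffErase k)).natDegree - 1) := by
  rw [tildeD, asPolyIn_pderiv, asPolyIn_discPoly, natDegree_derivative]

/-- The substitution of independent transcendentals for the variables, with `aᵢ ↦ 0`. -/
noncomputable def specialize (k : Idx n) (i : ℕ) : MvPolynomial (IdxErase k) ℂ →ₐ[ℂ] GenericField :=
  MvPolynomial.aeval fun j => genericCoeff i (j : Idx n)

lemma specialize_X (k : Idx n) (i : ℕ) (j : IdxErase k) :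
    specialize k i (MvPolynomial.X j) = genericCoeff i (j : Idx n) := by
  simp [specialize]

lemma specialize_varCoeffErase (k : Idx n) (i : ℕ) {j : ℕ} (hj : j ≤ n) (hjk : j ≠ k) :
    specialize k i (varCoeffErase k j) = genericCoeff i j := by
  obtain rfl | hj0 := Nat.eq_zero_or_pos j
  · rw [varCoeffErase_zero, map_one, genericCoeff_zero]
  · have h := varCoeffErase_coe k ⟨⟨j, hj0, hj⟩, fun h => hjk (congrArg Subtype.val h)⟩
    simp only at h
    rw [h, specialize_X]

lemma map_discIn_specialize (k : Idx n) (i : ℕ) :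
    (discIn n k (varCoeffErase k)).map (specialize k i : _ →+* GenericField) =
      discIn n k (genericCoeff i) := by
  rw [map_discIn]
  exact discIn_congr fun j hj hjk => specialize_varCoeffErase k i hj hjk

/-- Modulo `X m` the substitution fixes every generator. -/
lemma X_dvd_sub_aeval {σ : Type*} [DecidableEq σ] (m : σ) (p : MvPolynomial σ ℂ) :
    MvPolynomial.X m ∣ p - MvPolynomial.aeval
      (fun j => if j = m then (0 : MvPolynomial σ ℂ) else MvPolynomial.X j) p := by
  rw [← Ideal.mem_span_singleton, ← Ideal.Quotient.mk_eq_mk_iff_sub_mem]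
  set I := Ideal.span {(MvPolynomial.X m : MvPolynomial σ ℂ)}
  have h : (Ideal.Quotient.mkₐ ℂ I) = (Ideal.Quotient.mkₐ ℂ I).comp (MvPolynomial.aeval
      (fun j => if j = m then (0 : MvPolynomial σ ℂ) else MvPolynomial.X j)) := by
    refine MvPolynomial.algHom_ext fun j => ?_
    rw [AlgHom.comp_apply, MvPolynomial.aeval_X]
    split_ifs with hj
    · subst hj
      rw [map_zero]
      exact Ideal.Quotient.eq_zero_iff_mem.2 (Ideal.mem_span_singleton_self _)
    · rfl
  exact DFunLike.congr_fun h p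

/-- Substituting independent transcendentals for the variables is injective. -/
lemma aeval_genericVar_injective (k : Idx n) :
    Function.Injective (MvPolynomial.aeval (R := ℂ)
      fun j : IdxErase k => genericVar (j : Idx n)) := by
  have h : (MvPolynomial.aeval (R := ℂ) fun j : IdxErase k => genericVar (j : Idx n)) =
      (IsScalarTower.toAlgHom ℂ (MvPolynomial ℕ ℂ) GenericField).comp
        (MvPolynomial.rename fun j : IdxErase k => ((j : Idx n) : ℕ)) := by
    refine MvPolynomial.algHom_ext fun j => ?_
    simp [genericVar]
  rw [h, AlgHom.coe_comp]
  exact algebraMap_genericField_injective.comp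
    (MvPolynomial.rename_injective _ (Subtype.val_injective.comp Subtype.val_injective))

lemma genericCoeff_coe (k : Idx n) {i : ℕ} (j : IdxErase k) (h : ((j : Idx n) : ℕ) ≠ i) :
    genericCoeff i (j : Idx n) = genericVar (j : Idx n) := by
  have h1 : ((j : Idx n) : ℕ) ≠ 0 := by have := j.1.2.1; lia
  simp [genericCoeff, h1, h]

/-- The index `n + 1` is out of range, so no variable is sent to 0: this is the fully generic
specialization. -/
lemma specialize_injective (k : Idx n) : Function.Injective (specialize k (n + 1)) := by
  have : specialize k (n + 1) = MvPolynomial.aeval (R := ℂ)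
      fun j : IdxErase k => genericVar (j : Idx n) := by
    refine MvPolynomial.algHom_ext fun j => ?_
    rw [specialize_X, MvPolynomial.aeval_X, genericCoeff_coe]
    have := j.1.2.2; lia
  rw [this]
  exact aeval_genericVar_injective k

lemma specialize_eq_zero_iff (k : Idx n) (m : IdxErase k) (p : MvPolynomial (IdxErase k) ℂ) :
    specialize k (m : Idx n) p = 0 ↔ MvPolynomial.X m ∣ p := by
  classical
  constructor
  · intro h
    have h1 := X_dvd_sub_aeval m p
    set q := MvPolynomial.aeval
      (fun j => if j = m then (0 : MvPolynomial (IdxErase k) ℂ) else MvPolynomial.X j) p with hq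
    have h2 : specialize k (m : Idx n) = (MvPolynomial.aeval (R := ℂ)
        fun j : IdxErase k => genericVar (j : Idx n)).comp (MvPolynomial.aeval
          (fun j => if j = m then (0 : MvPolynomial (IdxErase k) ℂ) else MvPolynomial.X j)) := by
      refine MvPolynomial.algHom_ext fun j => ?_
      rw [specialize_X, AlgHom.comp_apply, MvPolynomial.aeval_X]
      split_ifs with hj
      · subst hj
        rw [map_zero, genericCoeff_self]
        have := j.1.2.1; lia
      · rw [MvPolynomial.aeval_X, genericCoeff_coe]
        exact fun h => hj (Subtype.ext (Subtype.ext h))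
    rw [h2, AlgHom.comp_apply, ← hq, map_eq_zero_iff _ (aeval_genericVar_injective k)] at h
    rwa [h, sub_zero] at h1
  · rintro ⟨q, rfl⟩
    have := m.1.2.1
    rw [map_mul, specialize_X, genericCoeff_self (by lia), zero_mul]

lemma natDegree_discIn_varCoeffErase (k : Idx n) :
    (discIn n k (varCoeffErase k)).natDegree = (discIn n k (genericCoeff (n + 1))).natDegree := by
  rw [← map_discIn_specialize, natDegree_map_eq_of_injective]
  exact specialize_injective k

lemma specialize_tildeD (k : Idx n) (i : ℕ) :
    specialize k i (tildeD k) =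
      resultant (discIn n k (genericCoeff i)) (derivative (discIn n k (genericCoeff i)))
        (discIn n k (genericCoeff (n + 1))).natDegree
        ((discIn n k (genericCoeff (n + 1))).natDegree - 1) := by
  rw [tildeD_eq, natDegree_discIn_varCoeffErase, ← map_discIn_specialize k i, derivative_map,
    resultant_map_map]
  rfl

/-- When the degree does not drop, the specialized resultant is the honest one, nonzero for a
polynomial with simple roots. -/
lemma not_X_dvd_tildeD (k : Idx n) (m : IdxErase k)
    (hd : (discIn n k (genericCoeff (m : Idx n))).natDegree =
      (discIn n k (genericCoeff (n + 1))).natDegree)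
    (h0 : discIn n k (genericCoeff (m : Idx n)) ≠ 0)
    (hs : (discIn n k (genericCoeff (m : Idx n))).roots.Nodup) :
    ¬ MvPolynomial.X m ∣ tildeD k := by
  rw [← specialize_eq_zero_iff, specialize_tildeD, ← hd]
  exact resultant_ne_zero_of_forall_root _ _ h0 (natDegree_derivative_le _)
    fun x hx => derivative_eval_ne_zero_of_nodup _ h0 hs hx

end Specialization
end DiscriminantProjections

namespace DiscriminantProjections

open Polynomial

/-! ### The exact power of the last variable. -/

section LastVariable

lemma discIn_of_last_eq_zero {A : Type*} [CommRing A] {n k : ℕ} (hn : 1 ≤ n) (hk : k ≤ n)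
    (c : ℕ → A) (h : c (n + 1) = 0) :
    discIn (n + 1) k c =
      (-1) ^ n * Function.update (fun j => C (c j)) k X n ^ 2 * discIn n k c := by
  rw [discIn, formalDisc_of_last_eq_zero hn _ (by rw [Function.update_of_ne (by lia), h, C_0]),
    discIn]

variable {n : ℕ}

lemma natDegree_discIn_of_lt (k : Idx n) (hk : (k : ℕ) < n) :
    (discIn n k (varCoeffErase k)).natDegree = n := by
  rw [natDegree_discIn_varCoeffErase,
    (discIn_generic_of_lt k.2.1 hk (by lia) (by lia) (by lia)).1]

lemma coeff_discIn_of_lt (k : Idx n) (hk : (k : ℕ) < n) (m : IdxErase k)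
    (hm : ((m : Idx n) : ℕ) = n) :
    (discIn n k (varCoeffErase k)).coeff n =
      ((k : ℕ) : MvPolynomial (IdxErase k) ℂ) ^ (k : ℕ) *
        ((-1) ^ n * (((k : ℕ) : MvPolynomial (IdxErase k) ℂ) - (n : MvPolynomial (IdxErase k) ℂ))) ^ (n - k) *
        MvPolynomial.X m ^ (n - k - 1) := by
  obtain ⟨h1, h2, -⟩ := discIn_generic_of_lt k.2.1 hk (i := n + 1) (by lia) (by lia) (by lia)
  apply specialize_injective k
  have h3 := congrArg (coeff · n) (map_discIn_specialize k (n + 1))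
  simp only [coeff_map] at h3
  rw [leadingCoeff, h1] at h2
  refine (h3.trans h2).trans ?_
  simp only [map_mul, map_pow, map_sub, map_neg, map_one, map_natCast, specialize_X, hm]

lemma cast_factor_ne_zero {k : ℕ} (hk : k ≠ 0) (hkn : k < n) :
    (k : GenericField) ^ k * ((-1) ^ n * ((k : GenericField) - n)) ^ (n - k) ≠ 0 := by
  refine mul_ne_zero (pow_ne_zero _ (Nat.cast_ne_zero.2 hk)) (pow_ne_zero _ (mul_ne_zero
    (pow_ne_zero _ (by simp)) (sub_ne_zero.2 (Nat.cast_injective.ne hkn.ne))))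

lemma X_pow_dvd_tildeD (k : Idx n) (hk : (k : ℕ) < n) (m : IdxErase k)
    (hm : ((m : Idx n) : ℕ) = n) :
    MvPolynomial.X m ^ (n - k - 1) ∣ tildeD k := by
  have hd := natDegree_discIn_of_lt k hk
  have hpos : 0 < (discIn n k (varCoeffErase k)).degree := by
    rw [← natDegree_pos_iff_degree_pos, hd]; lia
  rw [tildeD_eq, resultant_deriv hpos, leadingCoeff, hd, coeff_discIn_of_lt k hk m hm]
  exact Dvd.dvd.mul_right (Dvd.dvd.mul_left (Dvd.dvd.mul_left dvd_rfl _) _) _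

/-- The resultant of `f` and `n f - x f'`, with formal degrees, when `f` has simple nonzero roots
and the coefficient of `xⁿ` vanishes. -/
lemma resultant_euler_ne_zero {L : Type*} [Field L] [IsAlgClosed L] (f : L[X]) (hf : f ≠ 0)
    (hs : f.roots.Nodup) (h0 : f.eval 0 ≠ 0) :
    resultant f (C ((f.natDegree : L) + 1) * f - X * derivative f) (f.natDegree + 1)
      f.natDegree ≠ 0 := by
  set N := f.natDegree with hN
  set G := C ((N : L) + 1) * f - X * derivative f with hG
  have hXd : (X * derivative f).natDegree ≤ N := by
    obtain h | h := Nat.eq_zero_or_pos N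
    · rw [derivative_of_natDegree_zero (hN ▸ h)]; simp
    · refine natDegree_mul_le.trans ?_
      have := natDegree_derivative_le f
      rw [natDegree_X]; lia
  have hGd : G.natDegree ≤ N :=
    (natDegree_sub_le _ _).trans (max_le (natDegree_C_mul_le _ _) hXd)
  have hGN : G.coeff N = f.leadingCoeff := by
    rw [hG, coeff_sub, coeff_C_mul, leadingCoeff, ← hN]
    obtain h | ⟨M, h⟩ : N = 0 ∨ ∃ M, N = M + 1 := by
      obtain h | h := Nat.eq_zero_or_pos N
      · exact Or.inl h
      · exact Or.inr ⟨N - 1, by lia⟩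
    · rw [h]; simp
    · rw [h, coeff_X_mul, coeff_derivative]; push_cast; ring
  -- The formal degree of `f` exceeds its degree by one, at the cost of the factor `G.coeff N`,
  -- nonzero up to sign as it is the leading coefficient of `f`.
  rw [resultant_succ_left_deg _ _ _ _ hN.ge, hGN]
  refine mul_ne_zero (mul_ne_zero (pow_ne_zero _ (by simp)) (leadingCoeff_ne_zero.2 hf)) ?_
  refine resultant_ne_zero_of_forall_root f G hf hGd fun x hx => ?_
  have hx0 : x ≠ 0 := by rintro rfl; exact h0 hx
  rw [hG]
  simp only [eval_sub, eval_mul, eval_C, eval_X, hx, mul_zero, zero_sub]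
  exact neg_ne_zero.2 (mul_ne_zero hx0 (derivative_eval_ne_zero_of_nodup f hf hs hx))

/-- After cancelling `aₙⁿ⁻ᵏ⁻¹` from `coeff_zero_mul_resultant_derivative`, one more factor `aₙ`
would make `Res(f, nf - xf')` vanish at `aₙ = 0`. There `f` loses exactly one degree and
`resultant_euler_ne_zero` applies. -/
lemma not_X_pow_dvd_tildeD (k : Idx n) (hk : (k : ℕ) + 2 ≤ n) (m : IdxErase k)
    (hm : ((m : Idx n) : ℕ) = n) :
    ¬ MvPolynomial.X m ^ (n - k) ∣ tildeD k := by
  obtain ⟨N, rfl⟩ : ∃ N, n = N + 1 := ⟨n - 1, by lia⟩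
  have hk1 : 1 ≤ (k : ℕ) := k.2.1
  have hklt : (k : ℕ) < N + 1 := by lia
  have hd : (discIn (N + 1) k (varCoeffErase k)).natDegree = N + 1 := natDegree_discIn_of_lt k hklt
  have hcoeff := coeff_discIn_of_lt k hklt m hm
  have hD := tildeD_eq k
  have hF := map_discIn_specialize k (N + 1)
  set f := discIn (N + 1) k (varCoeffErase k) with hf
  set F := discIn (N + 1) k (genericCoeff (N + 1)) with hFdef
  set α := ((k : ℕ) : MvPolynomial (IdxErase k) ℂ) ^ (k : ℕ) *
    ((-1) ^ (N + 1) * (((k : ℕ) : MvPolynomial (IdxErase k) ℂ) - ((N + 1 : ℕ) :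
      MvPolynomial (IdxErase k) ℂ))) ^ (N + 1 - k) with hα
  set G := C ((N : MvPolynomial (IdxErase k) ℂ) + 1) * f - X * derivative f with hG
  have hid := coeff_zero_mul_resultant_derivative f hd.le
  rw [hd, Nat.add_sub_cancel] at hD
  rw [← hD, hcoeff, ← hG] at hid
  rintro ⟨q, hq⟩
  rw [hq, show N + 1 - (k : ℕ) = N + 1 - k - 1 + 1 by lia, Nat.add_sub_cancel,
    pow_succ (MvPolynomial.X m)] at hid
  have hX : (MvPolynomial.X m : MvPolynomial (IdxErase k) ℂ) ^ (N + 1 - (k : ℕ) - 1) ≠ 0 :=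
    pow_ne_zero _ (MvPolynomial.X_ne_zero m)
  have hdvd : MvPolynomial.X m ∣ α * resultant f G (N + 1) N := by
    refine ⟨f.coeff 0 * q, mul_left_cancel₀ hX ?_⟩
    linear_combination -hid
  rw [← specialize_eq_zero_iff, hm, map_mul] at hdvd
  have hα0 : specialize k (N + 1) α ≠ 0 := by
    rw [hα]
    simp only [map_mul, map_pow, map_sub, map_neg, map_one, map_natCast]
    exact cast_factor_ne_zero (by lia) hklt
  have hR : specialize k (N + 1) (resultant f G (N + 1) N) =
      resultant F (C ((N : GenericField) + 1) * F - X * derivative F) (N + 1) N := by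
    refine (resultant_map_map f G (N + 1) N (specialize k (N + 1) : _ →+* GenericField)).symm.trans ?_
    rw [hG, Polynomial.map_sub, Polynomial.map_mul, Polynomial.map_mul, map_C, map_X,
      ← derivative_map, hF, map_add, map_natCast, map_one]
  rw [hR] at hdvd
  have hres := (mul_eq_zero.1 hdvd).resolve_left hα0
  obtain ⟨g1, -, g3⟩ := discIn_generic_of_lt (n := N) (k := k) (i := N + 1) hk1 (by lia) (by lia)
    (by lia) (by lia)
  set g := discIn N k (genericCoeff (N + 1)) with hg
  have hgF : F = C ((-1) ^ N * genericCoeff (N + 1) N ^ 2) * g := by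
    rw [hFdef, discIn_of_last_eq_zero (by lia) (by lia) _ (genericCoeff_self (by lia)),
      Function.update_of_ne (by lia)]
    simp [hg]
  have hβ : (-1) ^ N * genericCoeff (N + 1) N ^ 2 ≠ 0 :=
    mul_ne_zero (pow_ne_zero _ (by simp)) (pow_ne_zero _ (genericCoeff_ne_zero (by lia)))
  have hFd : F.natDegree = N := by rw [hgF, natDegree_C_mul hβ, g1]
  have hF0 : F ≠ 0 := by intro h; rw [h, natDegree_zero] at hFd; lia
  have hFs : F.roots.Nodup := by rwa [hgF, roots_C_mul _ hβ]
  have hFe : F.eval 0 ≠ 0 := by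
    rw [hgF, eval_mul, eval_C]
    refine mul_ne_zero hβ fun h => ?_
    rw [hg, eval_discIn] at h
    obtain ⟨x, hx, hx'⟩ := exists_double_root
      (by rw [Function.update_of_ne (by lia), genericCoeff_zero]; exact one_ne_zero) h
    -- A zero constant term means a double root at `t = 0`; differentiating along the last
    -- coefficient yields `x⁰ = 0`.
    have := pow_eq_zero_of_double_root (l := N) (by lia) (by lia) le_rfl (by lia) (by lia) hx hx'
    simp at this
  have := resultant_euler_ne_zero F hF0 hFs hFe
  rw [hFd] at this
  exact this hres

/-- The value of the discriminant at `aₙ₋₁ = 0` is `aₙ` times a polynomial not divisible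
by `aₙ`. -/
lemma exists_coeff_zero_discIn (M : ℕ) (k : Idx (M + 2)) (hk : (k : ℕ) = M + 1)
    (m : IdxErase k) (hm : ((m : Idx (M + 2)) : ℕ) = M + 2) :
    ∃ u, (discIn (M + 2) k (varCoeffErase k)).coeff 0 = MvPolynomial.X m * u ∧
      specialize k (M + 2) u ≠ 0 := by
  set c := Function.update (varCoeffErase k) k 0 with hc
  have hc1 : c (M + 1) = 0 := by rw [hc, ← hk]; simp
  have hcm : c (M + 2) = MvPolynomial.X m := by
    have h := varCoeffErase_coe k m
    rw [hm] at h
    rw [hc, Function.update_of_ne (by lia), h]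
  refine ⟨_, by
    rw [coeff_zero_eq_eval_zero, eval_discIn, formalDisc_of_penultimate_eq_zero M _ hc1, hcm], ?_⟩
  set d := Function.update (genericCoeff (M + 2)) (M + 1) 0 with hd
  have hcd : ∀ j ≤ M + 2, specialize k (M + 2) (c j) = d j := by
    intro j hj
    obtain h | h := eq_or_ne j k
    · rw [hc, hd, h, ← hk]; simp
    · rw [hc, hd, Function.update_of_ne h, Function.update_of_ne (by lia),
        specialize_varCoeffErase k _ hj h]
  have hd0 : d 0 = 1 := by rw [hd, Function.update_of_ne (by lia), genericCoeff_zero]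
  have hd1 : d (M + 1) = 0 := by simp [hd]
  have hd2 : d (M + 2) = 0 := by
    rw [hd, Function.update_of_ne (by lia), genericCoeff_self (by lia)]
  have hdM : d M ≠ 0 := by
    rw [hd, Function.update_of_ne (by lia)]; exact genericCoeff_ne_zero (by lia)
  rw [map_mul, map_pow, map_neg, map_one, ← AlgHom.coe_toRingHom, ← resultant_map_map,
    map_genPoly, map_genPoly]
  have hP : genPoly (M + 2) (fun j => (specialize k (M + 2) : _ →+* GenericField) (c j)) =
      genPoly (M + 2) d := genPoly_congr hcd
  have hW : genPoly M (fun j => (specialize k (M + 2) : _ →+* GenericField)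
      (((M + 2 - j : ℕ) : MvPolynomial (IdxErase k) ℂ) * c j)) =
      genPoly M (fun j => ((M + 2 - j : ℕ) : GenericField) * d j) :=
    genPoly_congr fun j hj => by
      rw [map_mul, map_natCast]; exact congrArg _ (hcd j (by lia))
  rw [hP, hW]
  refine mul_ne_zero (pow_ne_zero _ (by simp)) ?_
  have hd0' : d 0 ≠ 0 := by rw [hd0]; exact one_ne_zero
  have := resultant_ne_zero_of_forall_root (genPoly (M + 2) d)
    (genPoly M (fun j => ((M + 2 - j : ℕ) : GenericField) * d j)) (n := M)
    (genPoly_ne_zero _ _ hd0') (natDegree_genPoly_le _ _) fun x hx hx' => ?_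
  · rwa [natDegree_genPoly _ _ hd0'] at this
  -- A common root of `P` and `P'/x` is a double root of `P`. Differentiating along the coefficient
  -- at `M` gives `x² = 0`; for `M = 0` that coefficient is the constant 1, but then `P = x²`.
  have hx0 : x = 0 := by
    obtain rfl | hM := Nat.eq_zero_or_pos M
    · rw [X_mul_genPoly 1 d hd2, X_mul_genPoly 0 d hd1] at hx
      simpa [genPoly, hd0] using hx
    · have hder : (derivative (genPoly (M + 2) d)).eval x = 0 := by
        rw [derivative_genPoly (M + 1) d, X_mul_genPoly M _ (by simp [hd1]), eval_mul, hx',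
          mul_zero]
      have := pow_eq_zero_of_double_root (n := M + 2) (k := M + 1) (i := M + 2) (l := M)
        (by lia) (by lia) (by lia) (by lia) (by lia) hx hder
      exact (pow_eq_zero_iff (by lia)).1 this
  rw [hx0, ← coeff_zero_eq_eval_zero, coeff_zero_genPoly] at hx'
  exact mul_ne_zero (Nat.cast_ne_zero.2 (by lia)) hdM hx'

/-- With `aₙ = 0`, the discriminant as a polynomial in `aₙ₋₁` is `aₙ₋₁²` times a polynomial with
simple nonzero roots. -/
lemma exists_discIn_eq_X_sq_mul (M : ℕ) :
    ∃ h : GenericField[X], discIn (M + 2) (M + 1) (genericCoeff (M + 2)) = X ^ 2 * h ∧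
      h.roots.Nodup ∧ h.eval 0 ≠ 0 := by
  refine ⟨C ((-1) ^ (M + 1)) * discIn (M + 1) (M + 1) (genericCoeff (M + 2)), ?_, ?_, ?_⟩
  · rw [discIn_of_last_eq_zero (by lia) (by lia) _ (genericCoeff_self (by lia)),
      Function.update_self]
    simp only [C_pow, C_neg, C_1]
    ring
  · rw [roots_C_mul _ (pow_ne_zero _ (by simp))]
    exact (discIn_generic_self (by lia) (by lia)).2
  · rw [eval_mul, eval_C]
    refine mul_ne_zero (pow_ne_zero _ (by simp)) fun h => ?_
    rw [eval_discIn] at h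
    obtain ⟨x, hx, hx'⟩ := exists_double_root
      (by rw [Function.update_of_ne (by lia), genericCoeff_zero]; exact one_ne_zero) h
    have hx0 : x = 0 := by
      obtain rfl | hM := Nat.eq_zero_or_pos M
      · rw [X_mul_genPoly 0 _ (by simp)] at hx
        simpa [genPoly, genericCoeff_zero] using hx
      · have := pow_eq_zero_of_double_root (l := M) le_rfl (by lia) (by lia) (by lia) (by lia)
          hx hx'
        exact (pow_eq_zero_iff (by lia)).1 this
    rw [hx0, derivative_genPoly, ← coeff_zero_eq_eval_zero, coeff_zero_genPoly,
      Function.update_of_ne (by lia)] at hx'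
    exact mul_ne_zero (Nat.cast_ne_zero.2 (by lia)) (genericCoeff_ne_zero (by lia)) hx'

/-- For `k = n - 1` the leading coefficient carries `aₙ` to the power 0, so it survives at `aₙ = 0`.
-/
lemma natDegree_discIn_penultimate (M : ℕ) (k : Idx (M + 2)) (hk : (k : ℕ) = M + 1)
    (m : IdxErase k) (hm : ((m : Idx (M + 2)) : ℕ) = M + 2) :
    (discIn (M + 2) k (genericCoeff (M + 2))).natDegree = M + 2 := by
  have hklt : (k : ℕ) < M + 2 := by lia
  rw [← map_discIn_specialize]
  refine natDegree_eq_of_le_of_coeff_ne_zero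
    (natDegree_map_le.trans (natDegree_discIn_of_lt k hklt).le) ?_
  rw [coeff_map, coeff_discIn_of_lt k hklt m hm, show M + 2 - (k : ℕ) - 1 = 0 by lia, pow_zero,
    mul_one]
  simp only [map_mul, map_pow, map_sub, map_neg, map_one, map_natCast]
  exact cast_factor_ne_zero (by lia) hklt

lemma X_dvd_tildeD_penultimate (M : ℕ) (k : Idx (M + 2)) (hk : (k : ℕ) = M + 1)
    (m : IdxErase k) (hm : ((m : Idx (M + 2)) : ℕ) = M + 2) :
    MvPolynomial.X m ∣ tildeD k := by
  have hd : (discIn (M + 2) k (genericCoeff (M + 2 + 1))).natDegree = M + 2 := by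
    rw [← natDegree_discIn_varCoeffErase, natDegree_discIn_of_lt k (by lia)]
  have hd' := natDegree_discIn_penultimate M k hk m hm
  obtain ⟨h, hF, -, -⟩ := exists_discIn_eq_X_sq_mul M
  rw [← hk] at hF
  rw [← specialize_eq_zero_iff, hm, specialize_tildeD, hd]
  have := resultant_eq_zero_of_root (discIn (M + 2) k (genericCoeff (M + 2)))
    (derivative (discIn (M + 2) k (genericCoeff (M + 2)))) ?_
    (natDegree_derivative_le _) 0 ?_ ?_
  · rwa [hd'] at this
  · intro h0; rw [h0, natDegree_zero] at hd'; lia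
  · rw [hF]; simp
  · rw [hF]; simp

/-- Both `f(0)` and `f'(0)` are multiples of `aₙ`, and `f(0)` of no higher power. Removing `aₙ`
leaves `Res(f, w)` with `w = (u f' - v f)/x`, which must be nonzero at `aₙ = 0`. -/
lemma not_X_sq_dvd_tildeD_penultimate (M : ℕ) (k : Idx (M + 2)) (hk : (k : ℕ) = M + 1)
    (m : IdxErase k) (hm : ((m : Idx (M + 2)) : ℕ) = M + 2) :
    ¬ MvPolynomial.X m ^ 2 ∣ tildeD k := by
  have hklt : (k : ℕ) < M + 2 := by lia
  obtain ⟨u, hu, hu0⟩ := exists_coeff_zero_discIn M k hk m hm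
  obtain ⟨h, hFh, hs, h0⟩ := exists_discIn_eq_X_sq_mul M
  have hd' := natDegree_discIn_penultimate M k hk m hm
  have hd := natDegree_discIn_of_lt k hklt
  have hD := tildeD_eq k
  have hmap := map_discIn_specialize k (M + 2)
  rw [← hk] at hFh
  set f := discIn (M + 2) k (varCoeffErase k) with hf
  set F := discIn (M + 2) k (genericCoeff (M + 2)) with hF
  have hFc : derivative F = X * (2 * h + X * derivative h) := by
    rw [hFh, pow_two, mul_assoc, derivative_mul, derivative_mul, derivative_X]; ring
  obtain ⟨v, hv⟩ : MvPolynomial.X m ∣ (derivative f).coeff 0 := by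
    rw [← specialize_eq_zero_iff, hm, ← AlgHom.coe_toRingHom, ← coeff_map, ← derivative_map,
      hmap, hFc]
    simp
  have key := coeff_mul_resultant_derivative f hd.le (MvPolynomial.X m) u v hu hv
  rw [hd, show M + 2 - 1 = M + 1 by lia] at hD
  rw [← hD] at key
  set w := C u * (derivative f).divX - C v * f.divX with hw
  rintro ⟨q, hq⟩
  have hX : (MvPolynomial.X m : MvPolynomial (IdxErase k) ℂ) ≠ 0 := MvPolynomial.X_ne_zero m
  have hune : u ≠ 0 := by rintro rfl; simp at hu0
  have hdvd : MvPolynomial.X m ∣ resultant f w (M + 2) (M + 1) := by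
    refine ⟨(-1) ^ (M + 2) * f.coeff (M + 2) * u ^ (M + 1) * q,
      mul_left_cancel₀ (mul_ne_zero hX hune) ?_⟩
    have hsgn : (-1 : MvPolynomial (IdxErase k) ℂ) ^ (M + 2) * (-1) ^ (M + 2) = 1 := by
      rw [← mul_pow]; simp
    rw [hq] at key
    linear_combination (-(-1) ^ (M + 2)) * key -
      MvPolynomial.X m * u * resultant f w (M + 2) (M + 1) * hsgn
  rw [← specialize_eq_zero_iff, hm, ← AlgHom.coe_toRingHom, ← resultant_map_map, hmap] at hdvd
  set u' := specialize k (M + 2) u with hu'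
  set v' := specialize k (M + 2) v with hv'
  have hdivX : ∀ p : (MvPolynomial (IdxErase k) ℂ)[X],
      p.divX.map (specialize k (M + 2) : _ →+* GenericField) =
        (p.map (specialize k (M + 2) : _ →+* GenericField)).divX := by
    intro p; ext j; simp [coeff_divX]
  have hdivX' : ∀ p : GenericField[X], (X * p).divX = p := by
    intro p; ext j; simp [coeff_divX]
  have hwm : w.map (specialize k (M + 2) : _ →+* GenericField) =
      C u' * (2 * h + X * derivative h) - C v' * (X * h) := by
    rw [hw, Polynomial.map_sub, Polynomial.map_mul, Polynomial.map_mul, map_C, map_C, hdivX,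
      hdivX, ← derivative_map, hmap, hFc, hdivX', hFh, pow_two, mul_assoc, hdivX']
    rfl
  have hwd : w.natDegree ≤ M + 1 := by
    have := natDegree_derivative_le f
    refine (natDegree_sub_le _ _).trans (max_le ?_ ?_) <;>
    · refine (natDegree_C_mul_le _ _).trans ?_
      rw [natDegree_divX_eq_natDegree_tsub_one]; lia
  have hne : F ≠ 0 := by intro h0; rw [h0, natDegree_zero] at hd'; lia
  have hhne : h ≠ 0 := by rintro rfl; simp at h0
  have := resultant_ne_zero_of_forall_root F (w.map (specialize k (M + 2) : _ →+* GenericField))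
    (n := M + 1) hne (natDegree_map_le.trans hwd) fun x hx => ?_
  · rw [hd'] at this
    exact this hdvd
  rw [hwm]
  -- With `F = x²h`, the specialized `w` equals `2u'h(0)` at 0 and `u' x h'(x)` at a root of `h`.
  obtain rfl | hx0 := eq_or_ne x 0
  · simp only [eval_sub, eval_mul, eval_C, eval_add, eval_X, eval_ofNat, zero_mul, mul_zero,
      add_zero, sub_zero]
    exact mul_ne_zero hu0 (mul_ne_zero two_ne_zero h0)
  · have hhx : h.eval x = 0 := by
      rw [hFh, eval_mul, eval_pow, eval_X] at hx
      exact (mul_eq_zero.1 hx).resolve_left (pow_ne_zero _ hx0)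
    simp only [eval_sub, eval_mul, eval_C, eval_add, eval_X, hhx, mul_zero, zero_add, sub_zero]
    exact mul_ne_zero hu0
      (mul_ne_zero hx0 (derivative_eval_ne_zero_of_nodup h hhne hs hhx))

end LastVariable

end DiscriminantProjections

/-! ### Assembly of the four claims. -/

theorem proposition1 (n : ℕ) :
    -- (1)
    (∀ k i : DiscriminantProjections.Idx n, (k : ℕ) + 1 ≤ n →
      ∀ hik : i ≠ k, (i : ℕ) ≠ n →
        ¬ (MvPolynomial.X ⟨i, hik⟩ ∣ DiscriminantProjections.tildeD k)) ∧
    -- (2)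
    (∀ k i : DiscriminantProjections.Idx n, (k : ℕ) = n →
      ∀ hik : i ≠ k,
        ¬ (MvPolynomial.X ⟨i, hik⟩ ∣ DiscriminantProjections.tildeD k)) ∧
    -- (3)
    (∀ k m : DiscriminantProjections.Idx n, (k : ℕ) + 2 ≤ n → (m : ℕ) = n →
      ∀ hmk : m ≠ k,
        (MvPolynomial.X ⟨m, hmk⟩ ^ (n - k - 1) ∣ DiscriminantProjections.tildeD k) ∧
        ¬ (MvPolynomial.X ⟨m, hmk⟩ ^ (n - k) ∣ DiscriminantProjections.tildeD k)) ∧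
    -- (4)
    (∀ k m : DiscriminantProjections.Idx n, (k : ℕ) + 1 = n → (m : ℕ) = n →
      ∀ hmk : m ≠ k,
        (MvPolynomial.X ⟨m, hmk⟩ ∣ DiscriminantProjections.tildeD k) ∧
        ¬ (MvPolynomial.X ⟨m, hmk⟩ ^ 2 ∣ DiscriminantProjections.tildeD k)) := by
  open DiscriminantProjections in
  refine ⟨fun k i hk hik hin => ?_, fun k i hk hik => ?_, fun k m hk hm hmk => ⟨?_, ?_⟩,
    fun k m hk hm hmk => ?_⟩
  · have hi := i.2.1
    have hki : (i : ℕ) ≠ k := fun h => hik (Subtype.ext h)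
    obtain ⟨h1, -, h3⟩ := discIn_generic_of_lt (n := n) (k := k) (i := i) k.2.1 (by lia) hin
      (by lia) hki
    have h4 := (discIn_generic_of_lt (n := n) (k := k) (i := n + 1) k.2.1 (by lia) (by lia)
      (by lia) (by lia)).1
    refine not_X_dvd_tildeD k ⟨i, hik⟩ (h1.trans h4.symm) (fun h => ?_) h3
    rw [h, Polynomial.natDegree_zero] at h1
    lia
  · have hi := i.2
    have hki : (i : ℕ) ≠ k := fun h => hik (Subtype.ext h)
    obtain ⟨N, rfl⟩ : ∃ N, n = N + 1 := ⟨n - 1, by have := hi.1; have := hi.2; lia⟩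
    have hi1 := hi.1
    have hi2 := hi.2
    obtain ⟨h1, h3⟩ := discIn_generic_self (n := N) (i := i) (by lia) (by lia)
    have h4 := (discIn_generic_self (n := N) (i := N + 1 + 1) (by lia) (by lia)).1
    refine not_X_dvd_tildeD k ⟨i, hik⟩ (by rw [hk, h1, h4]) (fun h => ?_) (by rw [hk]; exact h3)
    simp only [hk] at h
    rw [h, Polynomial.natDegree_zero] at h1
    -- Degree 0 would mean `N = 0`, leaving no index `i` other than `k`.
    lia
  · exact X_pow_dvd_tildeD k (by lia) ⟨m, hmk⟩ hm
  · exact not_X_pow_dvd_tildeD k hk ⟨m, hmk⟩ hm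
  · have hk1 := k.2.1
    obtain ⟨M, rfl⟩ : ∃ M, n = M + 2 := ⟨n - 2, by lia⟩
    exact ⟨X_dvd_tildeD_penultimate M k (by lia) ⟨m, hmk⟩ hm,
      not_X_sq_dvd_tildeD_penultimate M k (by lia) ⟨m, hmk⟩ hm⟩
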